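/- Let $Q=(-1/2,1/2)^2$. Let $A:\mathbb{R}^2\to\mathbb{R}^{2\times 2}$ be measurable, 1-periodic (that is, $A(y+z)=A(y)$ for all $y\in\mathbb{R}^2$, $z\in\mathbb{Z}^2$), symmetric and uniformly elliptic: $A_{ij}=A_{ji}$ and $\kappa_1|\xi|^2\le A_{ij}(y)\xi_i\xi_j\le\kappa_2|\xi|^2$ for a.e. $y$ and all $\xi\in\mathbb{R}^2$, with $\kappa_1>0$ (repeated indices are summed from $1$ to $2$). For $l=1,2$ let $N_l\in H^1_\sharp(Q)$ be the corrector, that is, the 1-periodic function with $\int_Q N_l=0$ that solves $-\operatorname{div}(A\nabla N_l)=\operatorname{div}(Ae_l)$ weakly with periodic boundary conditions, and assume that $N_l\in W^{1,\infty}_\sharp(Q)$. Here $W^{1,p}_\sharp(Q)$ is the space of 1-periodic functions in $W^{1,p}_{\mathrm{loc}}(\mathbb{R}^2)$, and $H^1_\sharp(Q)=W^{1,2}_\sharp(Q)$. Write $f^\epsilon(x)=f(x/\epsilon)$. Let $T\subset\mathbb{R}^2$ be a (nondegenerate, open) triangle with inradius $r$, let $w_0$ be a polynomial of degree at most $1$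 on $T$, let $0<\epsilon\le r$, and let $w_\epsilon\in H^1(T)$ be the weak solution of $$-\operatorname{div}(A^\epsilon\nabla w_\epsilon)=0\ \text{ in } T,\qquad w_\epsilon=w_0\ \text{ on }\partial T$$ (the boundary condition meaning $w_\epsilon-w_0\in H^1_0(T)$). Then $w_\epsilon-(w_0+\epsilon N_l^\epsilon\,\partial_l w_0)$ has a weak gradient in $L^2(T)$, and $$\bigl|w_\epsilon-(w_0+\epsilon N_l^\epsilon\,\partial_l w_0)\bigr|_{1,T}\le C\sqrt{\frac{\epsilon}{r}}\;|w_0|_{1,T},$$ where $|v|_{1,T}=\|\nabla v\|_{L^2(T)}$. The constant $C$ depends only on $\kappa_1$, $\kappa_2$ and (an upper bound for) $\max_l\|N_l\|_{W^{1,\infty}(Q)}$; in particular it depends neither on $T$, $\epsilon$, $w_0$ nor otherwise on $A$. -/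

import Mathlib

open MeasureTheory Filter Topology
open scoped ContDiff ENNReal

noncomputable section

namespace Homog

/-- The Euclidean plane `ℝ²`. -/
abbrev Plane : Type := EuclideanSpace ℝ (Fin 2)

/-- The `i`-th standard basis vector. -/
def e (i : Fin 2) : Plane := EuclideanSpace.single i (1 : ℝ)

/-- The classical partial derivative `∂ᵢ f (x)`. -/
def pd (i : Fin 2) (f : Plane → ℝ) (x : Plane) : ℝ := fderiv ℝ f x (e i)

/-- `C_c^∞(U)`. -/
structure IsTest (U : Set Plane) (φ : Plane → ℝ) : Prop where
  smooth : ContDiff ℝ ∞ φ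
  compact : HasCompactSupport φ
  support : tsupport φ ⊆ U

/-- `g` is a weak (distributional) gradient of `u` on the open set `U`. -/
structure HasWeakGrad (U : Set Plane) (u : Plane → ℝ) (g : Plane → Plane) : Prop where
  locInt : LocallyIntegrableOn u U volume
  locInt_grad : LocallyIntegrableOn g U volume
  byParts : ∀ φ : Plane → ℝ, IsTest U φ → ∀ i : Fin 2,
    ∫ x in U, u x * pd i φ x = - ∫ x in U, g x i * φ x

/-- The Sobolev space `H¹(U)`. -/
def MemH1 (U : Set Plane) (u : Plane → ℝ) : Prop :=
  MemLp u 2 (volume.restrict U) ∧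
    ∃ g : Plane → Plane, HasWeakGrad U u g ∧ MemLp g 2 (volume.restrict U)

/-- `H¹₀(U)`, the closure of `C_c^∞(U)` in `H¹(U)`. -/
def MemH10 (U : Set Plane) (u : Plane → ℝ) : Prop :=
  MemLp u 2 (volume.restrict U) ∧
    ∃ g : Plane → Plane, HasWeakGrad U u g ∧ MemLp g 2 (volume.restrict U) ∧
      ∃ φ : ℕ → Plane → ℝ, (∀ n, IsTest U (φ n)) ∧
        Tendsto (fun n => eLpNorm (fun x => u x - φ n x) 2 (volume.restrict U)) atTop (𝓝 0) ∧
        ∀ i : Fin 2, Tendsto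
          (fun n => eLpNorm (fun x => g x i - pd i (φ n) x) 2 (volume.restrict U)) atTop (𝓝 0)

/-- The seminorm `|u|_{1,U}`, the `L²(U)` norm of the weak gradient of `u`. The weak gradient is
unique up to null sets, so the infimum runs over equal numbers; it is `∞` if there is no weak
gradient on `U`, or none in `L²(U)`. -/
def h1Seminorm (U : Set Plane) (u : Plane → ℝ) : ℝ≥0∞ :=
  ⨅ (g : Plane → Plane) (_ : HasWeakGrad U u g), eLpNorm g 2 (volume.restrict U)

/-- The norm of `W^{1,∞}(U)`, the maximum of the `L^∞(U)` norms of `u`, `∂₁u`, `∂₂u`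
(`∞` if `u` is not in this space). -/
def w1InfNorm (U : Set Plane) (u : Plane → ℝ) : ℝ≥0∞ :=
  ⨅ (g : Plane → Plane) (_ : HasWeakGrad U u g),
    max (eLpNorm u ∞ (volume.restrict U))
      (⨆ i : Fin 2, eLpNorm (fun x => g x i) ∞ (volume.restrict U))

/-- The unit cell `Q = (-1/2, 1/2)²`. -/
def cell : Set Plane := {y | ∀ i, -(1 / 2 : ℝ) < y i ∧ y i < 1 / 2}

/-- 1-periodicity with respect to the lattice `ℤ²`. -/
def IsPeriodic {β : Type*} (f : Plane → β) : Prop :=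
  ∀ (x : Plane) (z : Fin 2 → ℤ), f (x + WithLp.toLp 2 (fun i => (z i : ℝ))) = f x

/-- The periodic Sobolev space `W^{1,p}_♯(Q)`: 1-periodic functions on the plane that are weakly
differentiable on the whole plane (hence across the faces of the cell), with the function and its
gradient in `L^p(Q)`. -/
def MemW1Per (p : ℝ≥0∞) (u : Plane → ℝ) : Prop :=
  IsPeriodic u ∧ MemLp u p (volume.restrict cell) ∧
    ∃ g : Plane → Plane, HasWeakGrad Set.univ u g ∧ MemLp g p (volume.restrict cell)

/-- `(B ξ) · η = B_{ij} ξ_j η_i`. -/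
def form (B : Matrix (Fin 2) (Fin 2) ℝ) (ξ η : Fin 2 → ℝ) : ℝ :=
  ∑ i, ∑ j, B i j * ξ j * η i

/-- A measurable coefficient matrix that is symmetric and uniformly elliptic with ellipticity
constants `κ₁`, `κ₂`, almost everywhere. -/
structure IsElliptic (κ₁ κ₂ : ℝ) (A : Plane → Matrix (Fin 2) (Fin 2) ℝ) : Prop where
  meas : ∀ i j, AEMeasurable (fun y => A y i j) volume
  symm : ∀ᵐ y, ∀ i j, A y i j = A y j i
  bounds : ∀ᵐ y, ∀ ξ : Plane,
    κ₁ * ‖ξ‖ ^ 2 ≤ form (A y) ξ ξ ∧ form (A y) ξ ξ ≤ κ₂ * ‖ξ‖ ^ 2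

/-- `f^ε (x) = f (x / ε)`. -/
def rescale {β : Type*} (ε : ℝ) (f : Plane → β) : Plane → β := fun x => f (ε⁻¹ • x)

/-- `N` is the `l`-th corrector of `A`: `N ∈ H¹_♯(Q)` has mean zero and solves
`-div (A ∇N) = div (A e_l)` weakly, against smooth 1-periodic functions. -/
def IsCorrector (A : Plane → Matrix (Fin 2) (Fin 2) ℝ) (l : Fin 2) (N : Plane → ℝ) : Prop :=
  MemW1Per 2 N ∧ (∫ y in cell, N y) = 0 ∧
    ∃ g : Plane → Plane, HasWeakGrad Set.univ N g ∧
      ∀ φ : Plane → ℝ, ContDiff ℝ ∞ φ → IsPeriodic φ →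
        (∫ y in cell, form (A y) (g y) (fun i => pd i φ y)) =
          - ∫ y in cell, form (A y) (e l) (fun i => pd i φ y)

/-- `w ∈ H¹(U)` is a weak solution of `-div (B ∇w) = 0` in `U`, `w = w₀` on `∂U`; the boundary
condition means `w - w₀ ∈ H¹₀(U)`. -/
def IsDirichletSolution (B : Plane → Matrix (Fin 2) (Fin 2) ℝ) (U : Set Plane)
    (w₀ w : Plane → ℝ) : Prop :=
  MemH1 U w ∧
    (∃ g : Plane → Plane, HasWeakGrad U w g ∧
      ∀ φ : Plane → ℝ, IsTest U φ → (∫ x in U, form (B x) (g x) (fun i => pd i φ x)) = 0) ∧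
    MemH10 U (fun x => w x - w₀ x)

/-- The first-order expansion `u₀ + ε N_l^ε ∂_l u₀`. -/
def firstOrder (ε : ℝ) (N : Fin 2 → Plane → ℝ) (u₀ : Plane → ℝ) : Plane → ℝ :=
  fun x => u₀ x + ε * ∑ l, rescale ε (N l) x * pd l u₀ x

/-- The open triangle with the given (affinely independent) vertices. -/
def openTriangle (T : Affine.Triangle ℝ Plane) : Set Plane :=
  interior (convexHull ℝ (Set.range T.points))

end Homog

end

/-! Let `p` be the constant gradient of `w₀` and put `v_l = ε N_l(·/ε)`. Each `x_l + v_l` solves the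
oscillating equation in the whole plane, so the error `wε - w₀ - p_l v_l` solves it in the triangle.
Its gradient is `F = D - p_l ∇v_l`, where `D` is the gradient of `wε - w₀ ∈ H¹₀`. The error itself
need not lie in `H¹₀`: the boundary values of `p_l v_l` are in the way.

Take a cutoff `ψ` supported in the triangle and equal to `1` at distance at least `ε` from the
boundary (`exists_cutoff`). Then `D - p_l ∇(ψ v_l)` is an admissible test gradient, and it equals `F
+ R` with `R = p_l ∇((1 - ψ) v_l)`. Hence `∫ B F · F = - ∫ B F · R`. The remainder `R` lives in the
boundary layer and is bounded there by a multiple of `M |p|`, because the size `ε M` of `v_l`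
compensates the slope `4 / ε` of `ψ`. Ellipticity and Young's inequality (`energy_bound`) leave
`‖F‖² ≤ C M² |p|² |layer|`.

The layer lies outside the homothetic copy of the triangle with ratio `1 - ε / r` about the
incenter, so its area is at most `2 (ε / r) |T|` (`exists_layer`). Since `|p|² |T|` is the squared
seminorm of `w₀`, the factor `√(ε / r)` appears. Beyond openness and boundedness, only convexity and
the inscribed ball matter, so no angle enters the constant.

Two passages need care. The corrector equation is tested on the cell with periodic functions and
must be moved to the plane (`integral_mul_pd_of_periodic`, by periodizing test functions). And `ψ
v_l` is only `W^{1,∞}`, so it is admitted as a test function by mollification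
(`integral_mul_grad_mul_eq_zero`). -/

noncomputable section

namespace Homog

/-! ### Test functions and weak gradients -/

section

variable {U : Set Plane} {u v φ ψ : Plane → ℝ} {g h : Plane → Plane}

theorem IsTest.pd (hφ : IsTest U φ) (i : Fin 2) : IsTest U (pd i φ) where
  smooth := (hφ.smooth.fderiv_right (m := ∞) (by simp)).clm_apply contDiff_const
  compact := hφ.compact.fderiv_apply (𝕜 := ℝ) (e i)
  support := (tsupport_fderiv_apply_subset ℝ (e i)).trans hφ.support

theorem IsTest.mono {V : Set Plane} (hφ : IsTest U φ) (h : U ⊆ V) : IsTest V φ :=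
  ⟨hφ.smooth, hφ.compact, hφ.support.trans h⟩

theorem IsTest.mul_smooth (hφ : IsTest U φ) (hu : ContDiff ℝ ∞ u) :
    IsTest U (fun x => φ x * u x) where
  smooth := hφ.smooth.mul hu
  compact := hφ.compact.mul_right
  support := (tsupport_mul_subset_left (f := φ) (g := u)).trans hφ.support

theorem IsTest.eq_zero (hφ : IsTest U φ) {x : Plane} (hx : x ∉ U) : φ x = 0 :=
  image_eq_zero_of_notMem_tsupport fun h => hx (hφ.support h)

theorem pd_mul (hφ : ContDiff ℝ ∞ φ) (hψ : ContDiff ℝ ∞ ψ) (i : Fin 2) (x : Plane) :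
    pd i (fun y => φ y * ψ y) x = φ x * pd i ψ x + ψ x * pd i φ x := by
  have h1 : DifferentiableAt ℝ φ x := (hφ.differentiable (by simp)).differentiableAt
  have h2 : DifferentiableAt ℝ ψ x := (hψ.differentiable (by simp)).differentiableAt
  simp only [pd]
  rw [show (fun y => φ y * ψ y) = φ * ψ from rfl, fderiv_mul h1 h2]
  simp

theorem IsTest.integrable_mul (hφ : IsTest U φ) {f : Plane → ℝ}
    (hf : LocallyIntegrableOn f U volume) : Integrable (fun x => f x * φ x) volume := by
  have hK : IntegrableOn f (tsupport φ) volume :=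
    hf.integrableOn_compact_subset hφ.support hφ.compact
  have := hK.mul_continuousOn hφ.smooth.continuous.continuousOn hφ.compact
  refine this.integrable_of_forall_notMem_eq_zero fun x hx => ?_
  simp [image_eq_zero_of_notMem_tsupport hx]

theorem LocallyIntegrableOn.coord (hg : LocallyIntegrableOn g U volume) (i : Fin 2) :
    LocallyIntegrableOn (fun x => g x i) U volume := by
  intro x hx
  obtain ⟨s, hs, hi⟩ := hg x hx
  exact ⟨s, hs, (EuclideanSpace.proj (𝕜 := ℝ) i).integrable_comp hi⟩

/-- Integrals of functions vanishing outside `U` do not see the restriction to `U`. -/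
theorem IsTest.setIntegral_mul (hφ : IsTest U φ) (f : Plane → ℝ) :
    ∫ x in U, f x * φ x = ∫ x, f x * φ x :=
  setIntegral_eq_integral_of_forall_compl_eq_zero fun x hx => by simp [hφ.eq_zero hx]

/-- This is the fundamental lemma of the calculus of variations, one coordinate at a time. It allows
the various gradients given by existential hypotheses to be identified with each other. -/
theorem HasWeakGrad.ae_eq (hU : IsOpen U) (hg : HasWeakGrad U u g) (hh : HasWeakGrad U u h) :
    g =ᵐ[volume.restrict U] h := by
  have key : ∀ i : Fin 2, ∀ᵐ x, x ∈ U → g x i - h x i = 0 := by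
    intro i
    have lg := LocallyIntegrableOn.coord hg.locInt_grad i
    have lh := LocallyIntegrableOn.coord hh.locInt_grad i
    refine hU.ae_eq_zero_of_integral_contDiff_smul_eq_zero (lg.sub lh) fun φ h1 h2 h3 => ?_
    have hφ : IsTest U φ := ⟨h1, h2, h3⟩
    have e1 := hg.byParts φ hφ i
    have e2 := hh.byParts φ hφ i
    rw [hφ.setIntegral_mul (fun x => g x i)] at e1
    rw [hφ.setIntegral_mul (fun x => h x i)] at e2
    have : ∫ x, φ x • (g x i - h x i) = (∫ x, g x i * φ x) - ∫ x, h x i * φ x := by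
      rw [← integral_sub (hφ.integrable_mul lg) (hφ.integrable_mul lh)]
      congr 1 with x
      simp only [smul_eq_mul]; ring
    change ∫ x, φ x • (g x i - h x i) = 0
    rw [this]; linarith
  rw [Filter.EventuallyEq, ae_restrict_iff' hU.measurableSet]
  filter_upwards [key 0, key 1] with x h0 h1 hx
  ext i
  fin_cases i
  · exact sub_eq_zero.1 (h0 hx)
  · exact sub_eq_zero.1 (h1 hx)

theorem HasWeakGrad.restrict (hg : HasWeakGrad Set.univ u g) : HasWeakGrad U u g where
  locInt := hg.locInt.mono_set (Set.subset_univ U)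
  locInt_grad := hg.locInt_grad.mono_set (Set.subset_univ U)
  byParts φ hφ i := by
    rw [(hφ.pd i).setIntegral_mul, hφ.setIntegral_mul (fun x => g x i)]
    simpa using hg.byParts φ (hφ.mono (Set.subset_univ U)) i

theorem HasWeakGrad.add (hg : HasWeakGrad U u g) (hh : HasWeakGrad U v h) :
    HasWeakGrad U (fun x => u x + v x) (fun x => g x + h x) where
  locInt := hg.locInt.add hh.locInt
  locInt_grad := hg.locInt_grad.add hh.locInt_grad
  byParts φ hφ i := by
    have a1 := ((hφ.pd i).integrable_mul hg.locInt).integrableOn (s := U)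
    have a2 := ((hφ.pd i).integrable_mul hh.locInt).integrableOn (s := U)
    have a3 := (hφ.integrable_mul (LocallyIntegrableOn.coord hg.locInt_grad i)).integrableOn (s := U)
    have a4 := (hφ.integrable_mul (LocallyIntegrableOn.coord hh.locInt_grad i)).integrableOn (s := U)
    simp only [PiLp.add_apply, add_mul]
    rw [integral_add a1 a2, integral_add a3 a4, hg.byParts φ hφ i, hh.byParts φ hφ i]
    ring

theorem HasWeakGrad.const_mul (hg : HasWeakGrad U u g) (c : ℝ) :
    HasWeakGrad U (fun x => c * u x) (fun x => c • g x) where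
  locInt := hg.locInt.smul c
  locInt_grad := hg.locInt_grad.smul c
  byParts φ hφ i := by
    simp only [PiLp.smul_apply, smul_eq_mul, mul_assoc]
    rw [integral_const_mul, integral_const_mul, hg.byParts φ hφ i]
    ring

theorem HasWeakGrad.sub (hg : HasWeakGrad U u g) (hh : HasWeakGrad U v h) :
    HasWeakGrad U (fun x => u x - v x) (fun x => g x - h x) := by
  simpa [sub_eq_add_neg] using hg.add (hh.const_mul (-1))

/-- The gradient vector of an affine function. -/
def affineGrad (w : Plane →ᵃ[ℝ] ℝ) : Plane := WithLp.toLp 2 fun i => w.linear (e i)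

theorem hasFDerivAt_affine (w : Plane →ᵃ[ℝ] ℝ) (x : Plane) :
    HasFDerivAt w (LinearMap.toContinuousLinearMap w.linear) x := by
  have h : (w : Plane → ℝ) = fun y => LinearMap.toContinuousLinearMap w.linear y + w 0 := by
    ext y
    simpa using congrFun w.decomp y
  rw [h]
  exact ((LinearMap.toContinuousLinearMap w.linear).hasFDerivAt).add_const _

theorem pd_affine (w : Plane →ᵃ[ℝ] ℝ) (i : Fin 2) (x : Plane) : pd i w x = affineGrad w i := by
  simp [pd, affineGrad, (hasFDerivAt_affine w x).fderiv]

theorem hasWeakGrad_affine (w : Plane →ᵃ[ℝ] ℝ) :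
    HasWeakGrad U w (fun _ => affineGrad w) := by
  have hc : Continuous w := continuous_iff_continuousAt.2 fun x =>
    (hasFDerivAt_affine w x).continuousAt
  refine HasWeakGrad.restrict ⟨hc.locallyIntegrable.locallyIntegrableOn _,
    continuous_const.locallyIntegrable.locallyIntegrableOn _, fun φ hφ i => ?_⟩
  simp only [Measure.restrict_univ]
  have lw : LocallyIntegrableOn w Set.univ volume := hc.locallyIntegrable.locallyIntegrableOn _
  have lc : LocallyIntegrableOn (fun _ : Plane => affineGrad w i) Set.univ volume :=
    continuous_const.locallyIntegrable.locallyIntegrableOn _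
  have hd : Differentiable ℝ φ := hφ.smooth.differentiable (by simp)
  have := integral_mul_fderiv_eq_neg_fderiv_mul_of_integrable (μ := volume) (f := w) (g := φ)
    (v := e i) ?_ ((hφ.pd i).integrable_mul lw) (hφ.integrable_mul lw)
    (fun x _ => (hasFDerivAt_affine w x).differentiableAt) (fun x _ => hd x)
  · refine this.trans ?_
    congr 2 with x
    rw [← pd_affine w i x, pd]
  · refine (hφ.integrable_mul lc).congr (Eventually.of_forall fun x => ?_)
    simp only [← pd_affine w i x, pd]

end

/-! ### Mollification -/

section

open scoped Convolution

variable {U : Set Plane} {u ψ : Plane → ℝ} {g H : Plane → Plane} {K : ℝ}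
  (b : ContDiffBump (0 : Plane))

/-- The mollification of `u` by the bump function `b`. -/
def mollify (u : Plane → ℝ) (x : Plane) : ℝ := ∫ t, u t * b.normed volume (x - t)

theorem mollify_eq_convolution :
    mollify b u = (u ⋆[ContinuousLinearMap.lsmul ℝ ℝ, volume] b.normed volume) := rfl

theorem mollify_eq_convolution_left (x : Plane) :
    mollify b u x = (b.normed volume ⋆[ContinuousLinearMap.lsmul ℝ ℝ, volume] u) x := by
  rw [convolution_lsmul_swap]
  simp only [mollify, smul_eq_mul, mul_comm]

theorem mollify_eq (x : Plane) : mollify b u x = ∫ t, b.normed volume t * u (x - t) := by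
  rw [mollify_eq_convolution_left, convolution_lsmul]
  rfl

theorem contDiff_mollify (hu : LocallyIntegrable u volume) : ContDiff ℝ ∞ (mollify b u) := by
  rw [mollify_eq_convolution]
  exact b.hasCompactSupport_normed.contDiff_convolution_right _ hu b.contDiff_normed

theorem isTest_bump_sub (x : Plane) :
    IsTest Set.univ (fun t => b.normed volume (x - t)) where
  smooth := b.contDiff_normed.comp (contDiff_const.sub contDiff_id)
  compact := b.hasCompactSupport_normed.comp_homeomorph (Homeomorph.subLeft x)
  support := Set.subset_univ _

/-- The derivative falls on the kernel, and `t ↦ b (x - t)` is itself a test function. The sign from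
the reflection `x - t` cancels the one from integration by parts. -/
theorem pd_mollify (hg : HasWeakGrad Set.univ u g) (i : Fin 2) (x : Plane) :
    pd i (mollify b u) x = mollify b (fun y => g y i) x := by
  have hu : LocallyIntegrable u volume := locallyIntegrableOn_univ.1 hg.locInt
  have hb : ContDiff ℝ ∞ (b.normed volume : Plane → ℝ) := b.contDiff_normed
  have h1 := b.hasCompactSupport_normed.hasFDerivAt_convolution_right
    (ContinuousLinearMap.lsmul ℝ ℝ) hu (hb.of_le (by simp)) (μ := volume) x
  have h2 := hg.byParts _ (isTest_bump_sub b x) i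
  have h3 : ∀ t, pd i (fun t => b.normed volume (x - t)) t = - pd i (b.normed volume) (x - t) := by
    intro t
    simp only [pd]
    have hd : HasFDerivAt (fun t : Plane => x - t) (-ContinuousLinearMap.id ℝ Plane) t :=
      (hasFDerivAt_id t).const_sub x
    have hn : HasFDerivAt (b.normed volume) (fderiv ℝ (b.normed volume) (x - t)) (x - t) :=
      ((hb.differentiable (by simp)) (x - t)).hasFDerivAt
    have hc : HasFDerivAt (fun t => b.normed volume (x - t)) _ t := hn.comp t hd
    rw [hc.fderiv]
    simp
  simp only [Measure.restrict_univ, h3, mul_neg, integral_neg, neg_inj] at h2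
  rw [mollify, ← h2, pd, mollify_eq_convolution, h1.fderiv, convolution_precompR_apply]
  · rfl
  · exact hu
  · exact b.hasCompactSupport_normed.fderiv ℝ
  · exact hb.continuous_fderiv (by simp)

theorem integral_bump_sub (x : Plane) : ∫ t, b.normed volume (x - t) = 1 := by
  rw [integral_sub_left_eq_self (fun t => b.normed volume t) volume x, b.integral_normed]

theorem abs_mollify_le (hK : ∀ᵐ x, |u x| ≤ K) (x : Plane) : |mollify b u x| ≤ K := by
  have hi : Integrable (fun t => b.normed volume (x - t)) volume :=
    integrable_of_integral_eq_one (integral_bump_sub b x)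
  calc |mollify b u x| ≤ ∫ t, K * b.normed volume (x - t) := by
        rw [mollify, ← Real.norm_eq_abs]
        refine norm_integral_le_of_norm_le (hi.const_mul K) ?_
        filter_upwards [hK] with t ht
        rw [norm_mul, Real.norm_eq_abs, Real.norm_of_nonneg (b.nonneg_normed _)]
        exact mul_le_mul_of_nonneg_right ht (b.nonneg_normed _)
    _ = K := by rw [integral_const_mul, integral_bump_sub, mul_one]

/-- A sequence of bump functions shrinking to the origin. -/
def shrinkingBump (n : ℕ) : ContDiffBump (0 : Plane) where
  rIn := 1 / ((n : ℝ) + 1)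
  -- The fixed ratio `rOut / rIn = 2` is what the almost everywhere convergence of the
  -- mollifications requires.
  rOut := 2 * (1 / ((n : ℝ) + 1))
  rIn_pos := by positivity
  rIn_lt_rOut := by
    have : (0 : ℝ) < 1 / ((n : ℝ) + 1) := by positivity
    linarith

theorem tendsto_mollify (hu : LocallyIntegrable u volume) :
    ∀ᵐ x, Tendsto (fun n => mollify (shrinkingBump n) u x) atTop (𝓝 (u x)) := by
  have h0 : Tendsto (fun n => (shrinkingBump n).rOut) atTop (𝓝 0) := by
    simpa [shrinkingBump] using
      (tendsto_one_div_add_atTop_nhds_zero_nat (𝕜 := ℝ)).const_mul 2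
  filter_upwards [ContDiffBump.ae_convolution_tendsto_right_of_locallyIntegrable (K := 2) h0
    (Eventually.of_forall fun n => le_rfl) hu] with x hx
  simpa only [mollify_eq_convolution_left] using hx

/-- A divergence free field is orthogonal to the gradient of the product of a test function and a
`W^{1,∞}` function. -/
theorem integral_mul_grad_mul_eq_zero (hH : IntegrableOn H U volume)
    (h0 : ∀ φ, IsTest U φ → ∫ x in U, ∑ i, H x i * pd i φ x = 0) (hψ : IsTest U ψ)
    (hg : HasWeakGrad Set.univ u g) (hu : ∀ᵐ x, |u x| ≤ K) (hgK : ∀ᵐ x, ∀ i, |g x i| ≤ K) :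
    ∫ x in U, ∑ i, H x i * (ψ x * g x i + u x * pd i ψ x) = 0 := by
  have lu : LocallyIntegrable u volume := locallyIntegrableOn_univ.1 hg.locInt
  have lg : ∀ i, LocallyIntegrable (fun x => g x i) volume := fun i =>
    locallyIntegrableOn_univ.1 (LocallyIntegrableOn.coord hg.locInt_grad i)
  have hK : 0 ≤ K := by
    obtain ⟨x, hx⟩ := hu.exists
    exact (abs_nonneg _).trans hx
  obtain ⟨C, hC⟩ := hψ.compact.exists_bound_of_continuous hψ.smooth.continuous
  have hCi : ∀ i, ∃ C, ∀ x, ‖pd i ψ x‖ ≤ C := fun i =>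
    (hψ.pd i).compact.exists_bound_of_continuous (hψ.pd i).smooth.continuous
  choose D hD using hCi
  have Hi : ∀ i, Integrable (fun x => H x i) (volume.restrict U) := fun i =>
    (EuclideanSpace.proj (𝕜 := ℝ) i).integrable_comp hH
  set F : ℕ → Plane → ℝ := fun n x => ∑ i, H x i *
    (ψ x * mollify (shrinkingBump n) (fun y => g y i) x +
      mollify (shrinkingBump n) u x * pd i ψ x) with hF
  -- Before the limit the second factor is smooth, so the product with `ψ` is a genuine test
  -- function.
  have hF0 : ∀ n, ∫ x in U, F n x = 0 := by
    intro n
    rw [← h0 _ (hψ.mul_smooth (contDiff_mollify (shrinkingBump n) lu))]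
    congr 1 with x
    refine Finset.sum_congr rfl fun i _ => ?_
    rw [pd_mul hψ.smooth (contDiff_mollify (shrinkingBump n) lu), pd_mollify _ hg]
  have hlim : Tendsto (fun n => ∫ x in U, F n x) atTop
      (𝓝 (∫ x in U, ∑ i, H x i * (ψ x * g x i + u x * pd i ψ x))) := by
    -- Mollification does not increase the bound `K`, so an integrable multiple of `|H|` dominates
    -- the whole sequence.
    refine tendsto_integral_of_dominated_convergence
      (fun x => ∑ i, |H x i| * (C * K + K * D i)) (fun n => ?_) ?_ (fun n => ?_) ?_
    · refine Finset.aestronglyMeasurable_fun_sum _ fun i _ => (Hi i).1.mul ?_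
      refine Continuous.aestronglyMeasurable ?_
      exact (hψ.smooth.continuous.mul (contDiff_mollify _ (lg i)).continuous).add
        ((contDiff_mollify _ lu).continuous.mul (hψ.pd i).smooth.continuous)
    · exact integrable_finsetSum _ fun i _ => (Hi i).abs.mul_const _
    · refine Eventually.of_forall fun x => (norm_sum_le _ _).trans ?_
      refine Finset.sum_le_sum fun i _ => ?_
      rw [norm_mul, Real.norm_eq_abs]
      refine mul_le_mul_of_nonneg_left ((norm_add_le _ _).trans ?_) (abs_nonneg _)
      rw [norm_mul, norm_mul]
      have hgi : ∀ᵐ x, |g x i| ≤ K := hgK.mono fun x h => h i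
      exact add_le_add
        (mul_le_mul (hC x) (abs_mollify_le _ hgi x) (abs_nonneg _) ((norm_nonneg _).trans (hC x)))
        (mul_le_mul (abs_mollify_le _ hu x) (hD i x) (norm_nonneg _) hK)
    · refine ae_restrict_of_ae ?_
      filter_upwards [tendsto_mollify lu, ae_all_iff.2 fun i => tendsto_mollify (lg i)] with x h1 h2
      exact tendsto_finsetSum _ fun i _ =>
        (((h2 i).const_mul _).add (h1.mul_const _)).const_mul _
  simp only [hF0] at hlim
  exact (tendsto_nhds_unique hlim tendsto_const_nhds)

end

/-! ### Dilations, translations and the lattice tiling -/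

section

variable {u φ : Plane → ℝ} {g : Plane → Plane} {s : ℝ}

theorem integral_comp_smul_add {F : Type*} [NormedAddCommGroup F] [NormedSpace ℝ F]
    (f : Plane → F) (s : ℝ) (a : Plane) :
    ∫ x, f (s • x + a) = |(s ^ Module.finrank ℝ Plane)⁻¹| • ∫ x, f x := by
  rw [Measure.integral_comp_smul volume (fun y => f (y + a)) s,
    integral_add_right_eq_self (fun y => f y) a]

theorem quasiMeasurePreserving_smul_add (hs : s ≠ 0) (a : Plane) :
    Measure.QuasiMeasurePreserving (fun x : Plane => s • x + a) volume volume :=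
  (measurePreserving_add_right volume a).quasiMeasurePreserving.comp
    (Measure.quasiMeasurePreserving_smul volume hs)

theorem ae_comp_smul_add {P : Plane → Prop} (h : ∀ᵐ y, P y) (hs : s ≠ 0) (a : Plane) :
    ∀ᵐ x : Plane, P (s • x + a) :=
  (quasiMeasurePreserving_smul_add hs a).ae h

theorem locallyIntegrable_comp_smul_add {F : Type*} [NormedAddCommGroup F]
    [NormedSpace ℝ F] {f : Plane → F} (hf : LocallyIntegrable f volume) (hs : s ≠ 0) (a : Plane) :
    LocallyIntegrable (fun x => f (s • x + a)) volume := by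
  rw [locallyIntegrable_iff] at hf ⊢
  intro k hk
  have hinj : Function.Injective (fun x : Plane => s • x + a) := fun x y h => by
    simpa [hs] using h
  have hc : Continuous (fun x : Plane => s • x + a) := by fun_prop
  have hk' := hk.image hc
  have h1 := (integrable_indicator_iff hk'.measurableSet).2 (hf _ hk')
  have h2 := (h1.comp_add_right a).comp_smul hs
  rw [← integrable_indicator_iff hk.measurableSet]
  refine h2.congr (Eventually.of_forall fun x => ?_)
  by_cases hx : x ∈ k
  · rw [Set.indicator_of_mem hx]
    exact Set.indicator_of_mem (Set.mem_image_of_mem _ hx) _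
  · rw [Set.indicator_of_notMem hx]
    exact Set.indicator_of_notMem (fun h => hx ((hinj.mem_set_image).1 h)) _

/-- The test function `y ↦ φ (s⁻¹ (y - a))`. -/
theorem IsTest.comp_inv (hφ : IsTest Set.univ φ) (hs : s ≠ 0) (a : Plane) :
    IsTest Set.univ (fun y => φ (s⁻¹ • (y - a))) where
  smooth := hφ.smooth.comp (g := φ) ((contDiff_id.sub contDiff_const).const_smul s⁻¹)
  compact := hφ.compact.comp_homeomorph
    ((Homeomorph.subRight a).trans (Homeomorph.smulOfNeZero s⁻¹ (inv_ne_zero hs)))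
  support := Set.subset_univ _

theorem pd_comp_inv (hφ : IsTest Set.univ φ) (hs : s ≠ 0) (a : Plane) (i : Fin 2) (x : Plane) :
    pd i φ x = s * pd i (fun y => φ (s⁻¹ • (y - a))) (s • x + a) := by
  have h1 : HasFDerivAt (fun y : Plane => s⁻¹ • (y - a))
      (s⁻¹ • ContinuousLinearMap.id ℝ Plane) (s • x + a) :=
    ((hasFDerivAt_id _).sub_const a).const_smul s⁻¹
  have h2 : s⁻¹ • (s • x + a - a) = x := by simp [hs]
  have h3 : HasFDerivAt φ (fderiv ℝ φ x) (s⁻¹ • (s • x + a - a)) := by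
    rw [h2]
    exact (hφ.smooth.differentiable (by simp) x).hasFDerivAt
  have h4 : HasFDerivAt (fun y : Plane => φ (s⁻¹ • (y - a))) _ (s • x + a) :=
    HasFDerivAt.comp (g := φ) (f := fun y : Plane => s⁻¹ • (y - a)) (s • x + a) h3 h1
  simp only [pd]
  rw [h4.fderiv]
  simp [hs]

/-- The test function is transported back by the inverse affine map; both sides acquire the same
Jacobian, which need not be evaluated. The case `s = 1` covers lattice translations, the case `s =
ε⁻¹` the rescaling. -/
theorem HasWeakGrad.comp_smul_add (hg : HasWeakGrad Set.univ u g) (hs : s ≠ 0) (a : Plane) :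
    HasWeakGrad Set.univ (fun x => u (s • x + a)) (fun x => s • g (s • x + a)) where
  locInt := (locallyIntegrable_comp_smul_add (locallyIntegrableOn_univ.1 hg.locInt) hs
    a).locallyIntegrableOn _
  locInt_grad := ((locallyIntegrable_comp_smul_add (locallyIntegrableOn_univ.1 hg.locInt_grad) hs
    a).smul s).locallyIntegrableOn _
  byParts φ hφ i := by
    have key := hg.byParts _ (hφ.comp_inv hs a) i
    have e2 : ∀ x : Plane, φ x = (fun y => φ (s⁻¹ • (y - a))) (s • x + a) := by
      intro x; simp [hs]
    set φ' : Plane → ℝ := fun y => φ (s⁻¹ • (y - a)) with hφ'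
    simp only [Measure.restrict_univ] at key ⊢
    have i1 := integral_comp_smul_add (fun y => u y * (s * pd i φ' y)) s a
    have i2 := integral_comp_smul_add (fun y => (s • g y) i * φ' y) s a
    simp only [pd_comp_inv hφ hs a i, ← hφ']
    rw [i1]
    have e3 : ∫ x, (s • g (s • x + a)) i * φ x = ∫ x, (s • g (s • x + a)) i * φ' (s • x + a) := by
      congr 1 with x
      rw [← e2]
    rw [e3, i2]
    simp only [PiLp.smul_apply, smul_eq_mul, mul_left_comm _ s, mul_assoc s]
    rw [integral_const_mul, integral_const_mul, key]
    ring

/-- A divergence free field on the plane stays divergence free after dilation. -/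
theorem integral_mul_pd_comp_smul {V : Plane → Plane} (hs : s ≠ 0)
    (hV : ∀ φ, IsTest Set.univ φ → ∫ x, ∑ i, V x i * pd i φ x = 0) (hφ : IsTest Set.univ φ) :
    ∫ x, ∑ i, V (s • x) i * pd i φ x = 0 := by
  have key := hV _ (hφ.comp_inv hs 0)
  have i1 := integral_comp_smul_add
    (fun y => s * ∑ i, V y i * pd i (fun y => φ (s⁻¹ • (y - 0))) y) s 0
  rw [integral_const_mul s (fun y => ∑ i, V y i * pd i (fun y => φ (s⁻¹ • (y - 0))) y), key, mul_zero,
    smul_zero] at i1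
  rw [← i1]
  congr 1 with x
  rw [Finset.mul_sum]
  refine Finset.sum_congr rfl fun i _ => ?_
  rw [pd_comp_inv hφ hs 0 i x, add_zero]
  ring

/-- The lattice vector with integer coordinates `z`. -/
def latticeVec (z : Fin 2 → ℤ) : Plane := WithLp.toLp 2 fun i => (z i : ℝ)

@[simp] theorem latticeVec_apply (z : Fin 2 → ℤ) (i : Fin 2) : latticeVec z i = z i := rfl

theorem latticeVec_add (z w : Fin 2 → ℤ) : latticeVec (z + w) = latticeVec z + latticeVec w := by
  ext i; simp

/-- The half-open unit cell centred at the lattice point `z`. -/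
def tile (z : Fin 2 → ℤ) : Set Plane := {y | (fun i => ⌊y i + 1 / 2⌋) = z}

theorem measurableSet_tile (z : Fin 2 → ℤ) : MeasurableSet (tile z) := by
  have : Measurable fun y : Plane => (fun i => ⌊y i + 1 / 2⌋ : Fin 2 → ℤ) := by
    refine measurable_pi_lambda _ fun i => Int.measurable_floor.comp ?_
    fun_prop
  exact this (MeasurableSet.singleton z)

theorem iUnion_tile : ⋃ z, tile z = Set.univ :=
  Set.eq_univ_of_forall fun _ => Set.mem_iUnion.2 ⟨_, rfl⟩

theorem pairwise_disjoint_tile : Pairwise (Function.onFun Disjoint tile) := by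
  intro z w hzw
  refine Set.disjoint_left.2 fun y hz hw => hzw ?_
  exact hz.symm.trans hw

theorem add_latticeVec_mem_tile (y : Plane) (z : Fin 2 → ℤ) :
    y + latticeVec z ∈ tile z ↔ y ∈ tile 0 := by
  have h : ∀ i, ⌊y i + z i + 1 / 2⌋ = ⌊y i + 1 / 2⌋ + z i := fun i => by
    rw [add_right_comm, Int.floor_add_intCast]
  simp only [tile, Set.mem_ofPred_eq, funext_iff, PiLp.add_apply, latticeVec_apply, h]
  simp

theorem cell_ae_eq_tile : cell =ᵐ[volume] tile 0 := by
  have hp := EuclideanSpace.volume_preserving_symm_measurableEquiv_toLp (Fin 2)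
  have h1 := (Measure.univ_pi_Ioo_ae_eq_Icc (μ := fun _ : Fin 2 => (volume : Measure ℝ))
    (f := fun _ => -(1 / 2 : ℝ)) (g := fun _ => 1 / 2)).trans
    (Measure.univ_pi_Ico_ae_eq_Icc (μ := fun _ : Fin 2 => (volume : Measure ℝ))
      (f := fun _ => -(1 / 2 : ℝ)) (g := fun _ => 1 / 2)).symm
  have h2 := hp.quasiMeasurePreserving.preimage_ae_eq h1
  have e1 : cell = (MeasurableEquiv.toLp 2 (Fin 2 → ℝ)).symm ⁻¹'
      (Set.univ.pi fun _ => Set.Ioo (-(1 / 2 : ℝ)) (1 / 2)) := by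
    ext y; simp [cell]
  have e2 : tile 0 = (MeasurableEquiv.toLp 2 (Fin 2 → ℝ)).symm ⁻¹'
      (Set.univ.pi fun _ => Set.Ico (-(1 / 2 : ℝ)) (1 / 2)) := by
    ext y
    simp only [tile, Set.mem_ofPred_eq, funext_iff, Pi.zero_apply, Int.floor_eq_zero_iff,
      Set.mem_preimage, Set.mem_univ_pi, Set.mem_Ico]
    refine forall_congr' fun i => ?_
    change (0 ≤ y i + 1 / 2 ∧ y i + 1 / 2 < 1) ↔ (-(1 / 2) ≤ y i ∧ y i < 1 / 2)
    constructor <;> rintro ⟨a, b⟩ <;> constructor <;> linarith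
  rw [e1, e2]
  exact h2

theorem setIntegral_tile (f : Plane → ℝ) (z : Fin 2 → ℤ) :
    ∫ x in tile z, f x = ∫ y in cell, f (y + latticeVec z) := by
  rw [setIntegral_congr_set cell_ae_eq_tile]
  have := (measurePreserving_add_right volume (latticeVec z)).setIntegral_preimage_emb
    (measurableEmbedding_addRight (latticeVec z)) f (tile z)
  rw [← this]
  congr 2
  ext y
  exact add_latticeVec_mem_tile y z

theorem hasSum_setIntegral_cell {f : Plane → ℝ} (hf : Integrable f volume) :
    HasSum (fun z => ∫ y in cell, f (y + latticeVec z)) (∫ x, f x) := by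
  have := hasSum_integral_iUnion (s := tile) (f := f) (μ := volume) measurableSet_tile
    pairwise_disjoint_tile hf.integrableOn
  simpa only [iUnion_tile, Measure.restrict_univ, setIntegral_tile] using this

/-- A property that is invariant under lattice translations and holds almost everywhere in the cell
holds almost everywhere. -/
theorem ae_of_ae_cell {P : Plane → Prop} (h : ∀ᵐ y ∂volume.restrict cell, P y)
    (hP : ∀ z, ∀ᵐ y, P y → P (y + latticeVec z)) : ∀ᵐ y, P y := by
  rw [Measure.restrict_congr_set cell_ae_eq_tile, ae_restrict_iff' (measurableSet_tile 0)] at h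
  have key : ∀ z : Fin 2 → ℤ, ∀ᵐ y, y ∈ tile z → P y := by
    intro z
    have q := (measurePreserving_add_right (volume : Measure Plane)
      (-latticeVec z)).quasiMeasurePreserving
    filter_upwards [q.ae h, q.ae (hP z)] with y h1 h2 hy
    rw [neg_add_cancel_right] at h2
    refine h2 (h1 ((add_latticeVec_mem_tile _ z).1 ?_))
    rwa [neg_add_cancel_right]
  filter_upwards [ae_all_iff.2 key] with y hy
  exact hy _ rfl

/-- The translated gradient is a weak gradient of the translated function, which is the same
function; uniqueness concludes. -/
theorem HasWeakGrad.ae_periodic (hg : HasWeakGrad Set.univ u g) (hu : IsPeriodic u)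
    (z : Fin 2 → ℤ) : ∀ᵐ y, g (y + latticeVec z) = g y := by
  have h := hg.comp_smul_add one_ne_zero (latticeVec z)
  simp only [one_smul] at h
  have hu' : (fun x => u (x + latticeVec z)) = u := funext fun x => hu x z
  rw [hu'] at h
  rw [← Measure.restrict_univ (μ := volume)]
  exact h.ae_eq isOpen_univ hg

end

/-! ### Periodization, flux bounds and the corrector equation on the plane -/

section

variable {u φ N : Plane → ℝ} {g V G : Plane → Plane} {κ₁ κ₂ K : ℝ}
  {A : Plane → Matrix (Fin 2) (Fin 2) ℝ}

theorem isOpen_cell : IsOpen cell := by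
  have : cell = ⋂ i : Fin 2, {y : Plane | -(1 / 2 : ℝ) < y i ∧ y i < 1 / 2} := by
    ext y; simp [cell]
  rw [this]
  refine isOpen_iInter_of_finite fun i => ?_
  have hc : Continuous fun y : Plane => y i := by fun_prop
  exact (isOpen_lt continuous_const hc).inter (isOpen_lt hc continuous_const)

theorem norm_le_one_of_mem_cell {y : Plane} (hy : y ∈ cell) : ‖y‖ ≤ 1 := by
  have h0 := hy 0
  have h1 := hy 1
  rw [EuclideanSpace.norm_eq, Real.sqrt_le_one, Fin.sum_univ_two]
  simp only [Real.norm_eq_abs, sq_abs]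
  nlinarith

theorem abs_le_norm_latticeVec (z : Fin 2 → ℤ) (i : Fin 2) : |(z i : ℝ)| ≤ ‖latticeVec z‖ :=
  PiLp.norm_apply_le (latticeVec z) i

/-- The periodization of a compactly supported function. -/
def periodize (φ : Plane → ℝ) (y : Plane) : ℝ := ∑' z, φ (y + latticeVec z)

/-- The lattice points in the box of half-width `n`. -/
def latticeBox (n : ℕ) : Finset (Fin 2 → ℤ) := Finset.Icc (fun _ => -(n : ℤ)) (fun _ => (n : ℤ))

theorem eq_zero_of_notMem_latticeBox {R : ℝ} (hR : ∀ x, R < ‖x‖ → φ x = 0) {n : ℕ} {y : Plane}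
    (hy : ‖y‖ + R ≤ n) {z : Fin 2 → ℤ} (hz : z ∉ latticeBox n) : φ (y + latticeVec z) = 0 := by
  have : ∃ i, (n : ℤ) < |z i| := by
    by_contra! h
    refine hz (Finset.mem_Icc.2 ⟨fun i => ?_, fun i => ?_⟩)
    · exact (abs_le.1 (h i)).1
    · exact (abs_le.1 (h i)).2
  obtain ⟨i, hi⟩ := this
  have hi' : (n : ℝ) < |(z i : ℝ)| := by exact_mod_cast hi
  have h1 := abs_le_norm_latticeVec z i
  have h2 : ‖latticeVec z‖ ≤ ‖y + latticeVec z‖ + ‖y‖ := by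
    simpa using norm_sub_le (y + latticeVec z) y
  exact hR _ (by linarith)

theorem periodize_eq_sum {R : ℝ} (hR : ∀ x, R < ‖x‖ → φ x = 0) {n : ℕ} {y : Plane}
    (hy : ‖y‖ + R ≤ n) : periodize φ y = ∑ z ∈ latticeBox n, φ (y + latticeVec z) :=
  tsum_eq_sum fun _ hz => eq_zero_of_notMem_latticeBox hR hy hz

theorem isPeriodic_periodize : IsPeriodic (periodize φ) := by
  intro x w
  change ∑' z, φ (x + latticeVec w + latticeVec z) = ∑' z, φ (x + latticeVec z)
  rw [← (Equiv.addLeft w).tsum_eq (fun z => φ (x + latticeVec z))]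
  simp [latticeVec_add, add_assoc]

/-- The extra `1` in the bound makes one finite box serve the whole unit ball around `y`, so that
the series can be differentiated as a finite sum. -/
theorem periodize_eventuallyEq {R : ℝ} (hR : ∀ x, R < ‖x‖ → φ x = 0) {n : ℕ} {y : Plane}
    (hy : ‖y‖ + 1 + R ≤ n) :
    periodize φ =ᶠ[𝓝 y] fun x => ∑ z ∈ latticeBox n, φ (x + latticeVec z) := by
  filter_upwards [Metric.ball_mem_nhds y one_pos] with x hx
  refine periodize_eq_sum hR (n := n) ?_
  have : ‖x‖ ≤ ‖y‖ + ‖x - y‖ := by simpa using norm_add_le y (x - y)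
  rw [mem_ball_iff_norm] at hx
  linarith

theorem contDiff_periodize (hφ : ContDiff ℝ ∞ φ) {R : ℝ} (hR : ∀ x, R < ‖x‖ → φ x = 0) :
    ContDiff ℝ ∞ (periodize φ) := by
  rw [contDiff_iff_contDiffAt]
  intro y
  obtain ⟨n, hn⟩ := exists_nat_ge (‖y‖ + 1 + R)
  refine ContDiffAt.congr_of_eventuallyEq ?_ (periodize_eventuallyEq hR hn)
  refine (ContDiff.sum fun z _ => ?_).contDiffAt
  exact hφ.comp (contDiff_id.add contDiff_const)

theorem pd_periodize (hφ : ContDiff ℝ ∞ φ) {R : ℝ} (hR : ∀ x, R < ‖x‖ → φ x = 0) {n : ℕ}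
    {y : Plane} (hy : ‖y‖ + 1 + R ≤ n) (i : Fin 2) :
    pd i (periodize φ) y = ∑ z ∈ latticeBox n, pd i φ (y + latticeVec z) := by
  have hd : Differentiable ℝ φ := hφ.differentiable (by simp)
  simp only [pd]
  rw [(periodize_eventuallyEq hR hy).fderiv_eq, fderiv_fun_sum]
  · simp only [fderiv_comp_add_right, sum_apply]
  · intro z _
    exact (hd _).comp _ (differentiableAt_id.add_const _)

/-- A periodic field that is divergence free against periodic test functions is divergence free
on the plane. -/
theorem integral_mul_pd_of_periodic (hV : LocallyIntegrable V volume)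
    (hper : ∀ z, ∀ᵐ y, V (y + latticeVec z) = V y)
    (h0 : ∀ φ : Plane → ℝ, ContDiff ℝ ∞ φ → IsPeriodic φ → ∫ y in cell, ∑ i, V y i * pd i φ y = 0)
    (hφ : IsTest Set.univ φ) : ∫ y, ∑ i, V y i * pd i φ y = 0 := by
  obtain ⟨R, hR⟩ := hφ.compact.isCompact.isBounded.subset_closedBall 0
  have hR1 : ∀ x, R < ‖x‖ → φ x = 0 := fun x hx => image_eq_zero_of_notMem_tsupport fun h => by
    have := hR h
    rw [mem_closedBall_zero_iff] at this
    linarith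
  have hR2 : ∀ i x, R < ‖x‖ → pd i φ x = 0 := fun i x hx =>
    image_eq_zero_of_notMem_tsupport fun h => by
      have := hR (tsupport_fderiv_apply_subset ℝ (e i) h)
      rw [mem_closedBall_zero_iff] at this
      linarith
  have hVi : ∀ i, LocallyIntegrableOn (fun x => V x i) Set.univ volume := fun i =>
    LocallyIntegrableOn.coord (hV.locallyIntegrableOn _) i
  -- One `1` bounds the norm on the cell, the other is the margin needed to differentiate, and `R`
  -- is the radius of the support.
  obtain ⟨n, hn⟩ := exists_nat_ge (1 + 1 + R)
  set f : Plane → ℝ := fun y => ∑ i, V y i * pd i φ y with hf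
  have hfi : Integrable f volume :=
    integrable_finsetSum _ fun i _ => (hφ.pd i).integrable_mul (hVi i)
  -- The plane is cut into translated cells, of which only finitely many meet the support of `φ`.
  -- Periodicity of `V` then gathers the translates of `φ` into `periodize φ`.
  have hsum : ∫ y, f y = ∑ z ∈ latticeBox n, ∫ y in cell, f (y + latticeVec z) := by
    rw [← (hasSum_setIntegral_cell hfi).tsum_eq]
    refine tsum_eq_sum fun z hz => ?_
    refine setIntegral_eq_zero_of_forall_eq_zero fun y hy => ?_
    refine Finset.sum_eq_zero fun i _ => ?_
    have := norm_le_one_of_mem_cell hy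
    rw [eq_zero_of_notMem_latticeBox (hR2 i) (n := n) (by linarith) hz, mul_zero]
  rw [hsum, ← h0 _ (contDiff_periodize hφ.smooth hR1) isPeriodic_periodize,
    ← integral_finsetSum _ fun z _ => (hfi.comp_add_right (latticeVec z)).integrableOn]
  refine setIntegral_congr_ae isOpen_cell.measurableSet ?_
  filter_upwards [ae_all_iff.2 hper] with y hy hyc
  have hy1 := norm_le_one_of_mem_cell hyc
  simp only [hf, hy, pd_periodize hφ.smooth hR1 (n := n) (y := y) (by linarith), Finset.mul_sum]
  rw [Finset.sum_comm]

/-- The flux `B ξ`. -/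
def flux (B : Matrix (Fin 2) (Fin 2) ℝ) (ξ : Plane) : Plane :=
  WithLp.toLp 2 fun i => ∑ j, B i j * ξ j

theorem form_eq_flux (B : Matrix (Fin 2) (Fin 2) ℝ) (ξ : Plane) (η : Fin 2 → ℝ) :
    form B ξ η = ∑ i, flux B ξ i * η i := by
  simp only [form, flux, Finset.sum_mul]

theorem flux_add (B : Matrix (Fin 2) (Fin 2) ℝ) (ξ η : Plane) :
    flux B (ξ + η) = flux B ξ + flux B η := by
  ext i; simp [flux, mul_add, Finset.sum_add_distrib]

theorem flux_sub (B : Matrix (Fin 2) (Fin 2) ℝ) (ξ η : Plane) :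
    flux B (ξ - η) = flux B ξ - flux B η := by
  ext i; simp [flux, mul_sub, Finset.sum_sub_distrib]

theorem flux_smul (B : Matrix (Fin 2) (Fin 2) ℝ) (c : ℝ) (ξ : Plane) :
    flux B (c • ξ) = c • flux B ξ := by
  ext i; simp [flux]; ring

theorem norm_flux_le {B : Matrix (Fin 2) (Fin 2) ℝ} (hB : ∀ i j, |B i j| ≤ K) (ξ : Plane) :
    ‖flux B ξ‖ ≤ 2 * K * ‖ξ‖ := by
  have hK : 0 ≤ K := (abs_nonneg _).trans (hB 0 0)
  have h : ∀ i, (B i 0 * ξ 0 + B i 1 * ξ 1) ^ 2 ≤ 2 * K ^ 2 * ‖ξ‖ ^ 2 := by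
    intro i
    have h0 : B i 0 ^ 2 ≤ K ^ 2 := sq_le_sq' (abs_le.1 (hB i 0)).1 (abs_le.1 (hB i 0)).2
    have h1 : B i 1 ^ 2 ≤ K ^ 2 := sq_le_sq' (abs_le.1 (hB i 1)).1 (abs_le.1 (hB i 1)).2
    rw [EuclideanSpace.real_norm_sq_eq, Fin.sum_univ_two]
    nlinarith [sq_nonneg (B i 0 * ξ 1 - B i 1 * ξ 0), sq_nonneg (ξ 0), sq_nonneg (ξ 1)]
  refine le_of_sq_le_sq ?_ (by positivity)
  rw [EuclideanSpace.real_norm_sq_eq, Fin.sum_univ_two]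
  simp only [flux, Fin.sum_univ_two]
  nlinarith [h 0, h 1]

theorem aestronglyMeasurable_flux {μ : Measure Plane} (hA : ∀ i j, AEMeasurable (fun y => A y i j) μ)
    (hG : AEStronglyMeasurable G μ) : AEStronglyMeasurable (fun y => flux (A y) (G y)) μ := by
  refine AEMeasurable.aestronglyMeasurable ?_
  have : AEMeasurable (fun y => (fun i => ∑ j, A y i j * G y j : Fin 2 → ℝ)) μ := by
    refine aemeasurable_pi_lambda _ fun i => Finset.aemeasurable_fun_sum _ fun j _ => (hA i j).mul ?_
    exact ((EuclideanSpace.proj (𝕜 := ℝ) j).continuous.comp_aestronglyMeasurable hG).aemeasurable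
  exact (MeasurableEquiv.toLp 2 (Fin 2 → ℝ)).measurable.comp_aemeasurable this

theorem memLp_flux {μ : Measure Plane} {p : ℝ≥0∞} (hA : ∀ i j, AEMeasurable (fun y => A y i j) μ)
    (hK : ∀ᵐ y ∂μ, ∀ i j, |A y i j| ≤ K) (hG : MemLp G p μ) :
    MemLp (fun y => flux (A y) (G y)) p μ := by
  refine hG.of_le_mul (c := 2 * K) (aestronglyMeasurable_flux hA hG.1) ?_
  filter_upwards [hK] with y hy using norm_flux_le hy _

theorem locallyIntegrable_flux (hA : ∀ i j, AEMeasurable (fun y => A y i j) volume)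
    (hK : ∀ᵐ y, ∀ i j, |A y i j| ≤ K) (hG : LocallyIntegrable G volume) :
    LocallyIntegrable (fun y => flux (A y) (G y)) volume := by
  rw [locallyIntegrable_iff] at hG ⊢
  intro k hk
  have := hG k hk
  rw [IntegrableOn, ← memLp_one_iff_integrable] at this ⊢
  exact memLp_flux (fun i j => (hA i j).restrict) (ae_restrict_of_ae hK) this

/-- Testing the form on the basis vectors bounds the diagonal entries and, by `κ₁ > 0`, makes them
positive. Testing on `(1, ±1)` and dropping the diagonal then bounds the off-diagonal entry. -/
theorem IsElliptic.abs_entry_le (hA : IsElliptic κ₁ κ₂ A) (hκ₁ : 0 < κ₁) :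
    ∀ᵐ y, ∀ i j, |A y i j| ≤ κ₂ := by
  filter_upwards [hA.symm, hA.bounds] with y hs hb
  have key : ∀ a b : ℝ, κ₁ * (a ^ 2 + b ^ 2) ≤
      A y 0 0 * a ^ 2 + 2 * A y 0 1 * a * b + A y 1 1 * b ^ 2 ∧
      A y 0 0 * a ^ 2 + 2 * A y 0 1 * a * b + A y 1 1 * b ^ 2 ≤ κ₂ * (a ^ 2 + b ^ 2) := by
    intro a b
    have h := hb !₂[a, b]
    rw [EuclideanSpace.real_norm_sq_eq, Fin.sum_univ_two] at h
    simp only [form, Fin.sum_univ_two, hs 1 0] at h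
    simp at h
    constructor <;> nlinarith [h.1, h.2]
  have k1 := key 1 0
  have k2 := key 0 1
  have k3 := key 1 1
  have k4 := key 1 (-1)
  have h00 : |A y 0 0| ≤ κ₂ := abs_le.2 ⟨by nlinarith, by nlinarith⟩
  have h11 : |A y 1 1| ≤ κ₂ := abs_le.2 ⟨by nlinarith, by nlinarith⟩
  have h01 : |A y 0 1| ≤ κ₂ := abs_le.2 ⟨by nlinarith, by nlinarith⟩
  have h10 : |A y 1 0| ≤ κ₂ := by rw [hs 1 0]; exact h01
  intro i j
  fin_cases i <;> fin_cases j <;> assumption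

/-- The corrected field `A (e_l + ∇N_l)` is divergence free on the plane. -/
theorem IsCorrector.integral_flux_eq_zero {l : Fin 2} (hN : IsCorrector A l N)
    (hA : IsElliptic κ₁ κ₂ A) (hκ₁ : 0 < κ₁) (hper : IsPeriodic A)
    (hg : HasWeakGrad Set.univ N g) (hφ : IsTest Set.univ φ) :
    ∫ y, ∑ i, flux (A y) (e l + g y) i * pd i φ y = 0 := by
  obtain ⟨⟨hNper, -⟩, -, g', hg', heq⟩ := hN
  -- The gradient in the corrector equation need not be the given `g`; the two agree almost
  -- everywhere.
  have hgg : g' =ᵐ[volume] g := by simpa using hg'.ae_eq isOpen_univ hg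
  have lg : LocallyIntegrable g volume := locallyIntegrableOn_univ.1 hg.locInt_grad
  have le : LocallyIntegrable (fun _ : Plane => e l) volume := continuous_const.locallyIntegrable
  have l1 := locallyIntegrable_flux hA.meas (hA.abs_entry_le hκ₁) lg
  have l2 := locallyIntegrable_flux hA.meas (hA.abs_entry_le hκ₁) le
  have l3 := locallyIntegrable_flux hA.meas (hA.abs_entry_le hκ₁) (le.add lg)
  refine integral_mul_pd_of_periodic l3 (fun z => ?_) (fun φ hφ hφp => ?_) hφ
  · filter_upwards [hg.ae_periodic hNper z] with y hy
    have : A (y + latticeVec z) = A y := hper y z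
    simp [hy, this]
  · have hWint : ∀ {W : Plane → Plane}, LocallyIntegrable W volume →
        IntegrableOn (fun y => ∑ i, W y i * pd i φ y) cell volume := by
      intro W hW
      refine integrable_finsetSum _ fun i _ => ?_
      have hc : Continuous (pd i φ) :=
        ((hφ.fderiv_right (m := ∞) (by simp)).clm_apply contDiff_const).continuous
      have hWi := locallyIntegrableOn_univ.1
        (LocallyIntegrableOn.coord (hW.locallyIntegrableOn Set.univ) i)
      have hball := isCompact_closedBall (0 : Plane) 1
      refine IntegrableOn.mono_set
        ((hWi.integrableOn_isCompact hball).mul_continuousOn hc.continuousOn hball) fun y hy => ?_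
      rw [mem_closedBall_zero_iff]
      exact norm_le_one_of_mem_cell hy
    have e1 := heq φ hφ hφp
    simp only [form_eq_flux] at e1
    have e2 : ∫ y in cell, ∑ i, flux (A y) (g' y) i * pd i φ y =
        ∫ y in cell, ∑ i, flux (A y) (g y) i * pd i φ y := by
      refine integral_congr_ae (ae_restrict_of_ae ?_)
      filter_upwards [hgg] with y hy
      rw [hy]
    have e3 : ∀ y, ∑ i, flux (A y) (e l + g y) i * pd i φ y =
        ∑ i, flux (A y) (e l) i * pd i φ y + ∑ i, flux (A y) (g y) i * pd i φ y := by
      intro y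
      simp only [flux_add, PiLp.add_apply, add_mul, Finset.sum_add_distrib]
    calc ∫ y in cell, ∑ i, flux (A y) (e l + g y) i * pd i φ y
        = (∫ y in cell, ∑ i, flux (A y) (e l) i * pd i φ y) +
          ∫ y in cell, ∑ i, flux (A y) (g y) i * pd i φ y := by
          simp only [e3]
          exact integral_add (hWint l2) (hWint l1)
      _ = 0 := by rw [← e2, e1, add_neg_cancel]

theorem abs_le_max_of_enorm_le {x M : ℝ} (h : ‖x‖ₑ ≤ ENNReal.ofReal M) : |x| ≤ max M 0 := by
  rw [Real.enorm_eq_ofReal_abs, ENNReal.ofReal_le_ofReal_iff'] at h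
  rcases h with h | h
  · exact h.trans (le_max_left _ _)
  · exact h.trans (le_max_right _ _)

/-- The infimum in the norm runs over gradients that agree almost everywhere, so the bound holds for
the given `g`; periodicity spreads it from the cell to the plane. The maximum with `0` appears
because `M` carries no sign. -/
theorem ae_bound_of_w1InfNorm_le {M : ℝ} (hN : IsPeriodic N) (hg : HasWeakGrad Set.univ N g)
    (h : w1InfNorm cell N ≤ ENNReal.ofReal M) :
    (∀ᵐ y, |N y| ≤ max M 0) ∧ ∀ᵐ y, ∀ i, |g y i| ≤ max M 0 := by
  have key : max (eLpNorm N ∞ (volume.restrict cell))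
      (⨆ i : Fin 2, eLpNorm (fun x => g x i) ∞ (volume.restrict cell)) ≤ ENNReal.ofReal M := by
    refine le_trans (le_iInf₂ fun g' hg' => ?_) h
    have := (hg.restrict (U := cell)).ae_eq isOpen_cell hg'
    refine max_le_max le_rfl (iSup_mono fun i => le_of_eq ?_)
    exact eLpNorm_congr_ae (this.mono fun x hx => by simp only [hx])
  have ess : ∀ f : Plane → ℝ, eLpNorm f ∞ (volume.restrict cell) ≤ ENNReal.ofReal M →
      ∀ᵐ y ∂volume.restrict cell, |f y| ≤ max M 0 := by
    intro f hf
    rw [eLpNorm_exponent_top] at hf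
    filter_upwards [ae_le_eLpNormEssSup (f := f)] with y hy
    exact abs_le_max_of_enorm_le (hy.trans hf)
  constructor
  · refine ae_of_ae_cell (ess N ((le_max_left _ _).trans key)) fun z => ?_
    refine Eventually.of_forall fun y hy => ?_
    rwa [show N (y + latticeVec z) = N y from hN y z]
  · refine ae_of_ae_cell (ae_all_iff.2 fun i => ess (fun x => g x i) ?_) fun z => ?_
    · exact (le_iSup (fun i : Fin 2 => eLpNorm (fun x => g x i) ∞ (volume.restrict cell)) i).trans
        ((le_max_right _ _).trans key)
    · filter_upwards [hg.ae_periodic hN z] with y hy h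
      rwa [hy]

end

/-! ### Inscribed ball, boundary layer and cutoff -/

section

variable {U : Set Plane} {c : Plane} {r ε : ℝ}

/-- The signed distance to a side is `1`-Lipschitz and equals the inradius at the incenter, so it is
positive on the ball. It is also the barycentric weight times the height, so all weights are
positive. -/
theorem ball_subset_openTriangle (T : Affine.Triangle ℝ Plane) :
    Metric.ball T.incenter T.inradius ⊆ openTriangle T := by
  refine interior_maximal (fun x hx => ?_) Metric.isOpen_ball
  have htop : affineSpan ℝ (Set.range T.points) = ⊤ := by
    rw [T.independent.affineSpan_eq_top_iff_card_eq_finrank_add_one]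
    simp
  obtain ⟨w, hw, rfl⟩ := eq_affineCombination_of_mem_affineSpan_of_fintype
    (p := T.points) (show x ∈ affineSpan ℝ (Set.range T.points) by rw [htop]; trivial)
  refine affineCombination_mem_convexHull (fun i _ => ?_) hw
  set x := Finset.univ.affineCombination ℝ T.points w with hxdef
  have h1 : |T.signedInfDist i T.incenter - T.signedInfDist i x| ≤ dist x T.incenter := by
    simp only [Affine.Simplex.signedInfDist, AffineSubspace.signedInfDist_def,
      signedDist_triangle_left]
    exact abs_signedDist_le_dist _ _ _
  rw [T.signedInfDist_incenter] at h1
  have h2 := T.signedInfDist_affineCombination i hw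
  rw [Metric.mem_ball] at hx
  have h3 : 0 < T.signedInfDist i x := by
    have := (abs_le.1 h1).2
    linarith
  rw [hxdef, h2] at h3
  by_contra! hneg
  exact absurd h3 (not_lt.2 (mul_nonpos_of_nonpos_of_nonneg hneg.le (norm_nonneg _)))

theorem convex_openTriangle (T : Affine.Triangle ℝ Plane) : Convex ℝ (openTriangle T) :=
  (convex_convexHull ℝ _).interior

theorem isBounded_openTriangle (T : Affine.Triangle ℝ Plane) :
    Bornology.IsBounded (openTriangle T) :=
  (isBounded_convexHull.2 (Set.finite_range T.points).isBounded).subset interior_subset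

/-- With `t = ε / r`, a point within `ε` of `(1 - t) y + t c` is `(1 - t) y + t z` with `z` in the
ball of radius `r` about `c`; convexity does the rest. -/
theorem ball_homothety_subset (hU : Convex ℝ U) (hr : Metric.ball c r ⊆ U) (hε : 0 < ε)
    (hεr : ε ≤ r) {y : Plane} (hy : y ∈ U) :
    Metric.ball (AffineMap.homothety c (1 - ε / r) y) ε ⊆ U := by
  intro x hx
  have hr0 : 0 < r := hε.trans_le hεr
  set t := ε / r with ht
  have ht0 : 0 < t := div_pos hε hr0
  have ht1 : t ≤ 1 := (div_le_one hr0).2 hεr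
  have htr : t * r = ε := div_mul_cancel₀ ε hr0.ne'
  set q : Plane := AffineMap.homothety c (1 - t) y with hq
  have hq' : q = (1 - t) • y + t • c := by
    simp only [hq, AffineMap.homothety_apply, vsub_eq_sub, vadd_eq_add]
    module
  have hmem : c + t⁻¹ • (x - q) ∈ U := by
    refine hr ?_
    rw [mem_ball_iff_norm, add_sub_cancel_left, norm_smul, Real.norm_eq_abs, abs_of_pos
      (inv_pos.2 ht0), inv_mul_lt_iff₀ ht0, htr]
    rwa [mem_ball_iff_norm] at hx
  have := hU hy hmem (sub_nonneg.2 ht1) ht0.le (by ring)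
  convert this using 1
  rw [smul_add, smul_smul, mul_inv_cancel₀ ht0.ne', one_smul, ← add_assoc, ← hq']
  module

/-- The boundary layer of width `ε` of a convex set containing a ball of radius `r` fills at most
the fraction `2 ε / r` of its area. -/
theorem exists_layer (hUo : IsOpen U) (hU : Convex ℝ U) (hUb : Bornology.IsBounded U)
    (hr : Metric.ball c r ⊆ U) (hε : 0 < ε) (hεr : ε ≤ r) :
    ∃ L : Set Plane, MeasurableSet L ∧ L ⊆ U ∧
      volume L ≤ ENNReal.ofReal (2 * (ε / r)) * volume U ∧
      ∀ x ∈ U, x ∉ L → Metric.ball x ε ⊆ U := by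
  have hr0 : 0 < r := hε.trans_le hεr
  have ht0 : 0 < ε / r := div_pos hε hr0
  rcases hεr.eq_or_lt with h | h
  -- For `ε = r` the homothety collapses to a point and is not open, so the layer is all of `U`.
  · refine ⟨U, hUo.measurableSet, subset_rfl, ?_, fun x hx hx' => absurd hx hx'⟩
    rw [h, div_self hr0.ne']
    refine le_mul_of_one_le_left zero_le ?_
    rw [ENNReal.one_le_ofReal]; norm_num
  · have ht1 : ε / r < 1 := (div_lt_one hr0).2 h
    set S := AffineMap.homothety c (1 - ε / r) '' U with hS
    have hSo : IsOpen S := AffineMap.homothety_isOpenMap c _ (sub_pos.2 ht1).ne' _ hUo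
    have hball : ∀ x ∈ S, Metric.ball x ε ⊆ U := by
      rintro _ ⟨y, hy, rfl⟩
      exact ball_homothety_subset hU hr hε hεr hy
    have hSU : S ⊆ U := fun x hx => hball x hx (Metric.mem_ball_self hε)
    have hfin : volume U ≠ ⊤ := hUb.measure_lt_top.ne
    refine ⟨U \ S, hUo.measurableSet.diff hSo.measurableSet, Set.sdiff_subset, ?_,
      fun x hx hx' => hball x ?_⟩
    · rw [measure_sdiff hSU hSo.measurableSet.nullMeasurableSet
        (measure_ne_top_of_subset hSU hfin), hS, Measure.addHaar_image_homothety,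
        tsub_le_iff_right, ← add_mul, ← ENNReal.ofReal_add (by positivity) (abs_nonneg _)]
      refine le_mul_of_one_le_left zero_le ?_
      rw [ENNReal.one_le_ofReal, finrank_euclideanSpace_fin, abs_of_nonneg (sq_nonneg _)]
      -- With `t = ε / r` this is `1 ≤ 2 t + (1 - t)²`.
      nlinarith [sq_nonneg (ε / r)]
    · by_contra hxS
      exact hx' ⟨hx, hxS⟩

/-- A mollification is an average of translates, all with the same Lipschitz constant. This keeps
the slope `4 / ε` of the cutoff after smoothing. -/
theorem LipschitzWith.mollify {f : Plane → ℝ} {K : NNReal} (hf : LipschitzWith K f)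
    (b : ContDiffBump (0 : Plane)) : LipschitzWith K (mollify b f) := by
  refine LipschitzWith.of_dist_le_mul fun x y => ?_
  have hWint : ∀ x, Integrable (fun t => b.normed volume t * f (x - t)) volume := fun x => by
    refine Continuous.integrable_of_hasCompactSupport ?_ b.hasCompactSupport_normed.mul_right
    exact (b.continuous_normed).mul (hf.continuous.comp (by fun_prop))
  rw [Real.dist_eq, mollify_eq, mollify_eq, ← integral_sub (hWint x) (hWint y), ← Real.norm_eq_abs]
  calc ‖∫ t, (b.normed volume t * f (x - t) - b.normed volume t * f (y - t))‖
      ≤ ∫ t, b.normed volume t * (K * dist x y) := by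
        refine norm_integral_le_of_norm_le
          ((integrable_of_integral_eq_one b.integral_normed).mul_const _)
          (Eventually.of_forall fun t => ?_)
        rw [← mul_sub, norm_mul, Real.norm_of_nonneg (b.nonneg_normed _)]
        refine mul_le_mul_of_nonneg_left ?_ (b.nonneg_normed _)
        simpa [Real.dist_eq] using hf.dist_le_mul (x - t) (y - t)
    _ = K * dist x y := by rw [integral_mul_const, b.integral_normed, one_mul]

/-- A smooth cutoff function that equals `1` at distance at least `ε` from the complement. -/
theorem exists_cutoff (hUb : Bornology.IsBounded U) (hε : 0 < ε) :
    ∃ ψ : Plane → ℝ, IsTest U ψ ∧ (∀ x, |ψ x| ≤ 1) ∧ (∀ i x, |pd i ψ x| ≤ 4 / ε) ∧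
      ∀ x, Metric.ball x ε ⊆ U → ψ x = 1 ∧ ∀ i, pd i ψ x = 0 := by
  -- `Metric.infDist` to the empty set is `0`, so the lower bound on the distance below needs a
  -- point of the complement.
  have hne : (Uᶜ).Nonempty := by
    rw [Set.nonempty_compl]
    rintro rfl
    exact NormedSpace.unbounded_univ ℝ Plane hUb
  set d : Plane → ℝ := fun x => Metric.infDist x Uᶜ with hd
  have hd1 : ∀ x y, d x ≤ d y + dist x y := fun x y => Metric.infDist_le_infDist_add_dist
  set f : Plane → ℝ := fun x => max 0 (min 1 (4 / ε * d x - 1)) with hf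
  have hK : (0 : ℝ) ≤ 4 / ε := by positivity
  have hlip : LipschitzWith ⟨4 / ε, hK⟩ f := by
    refine LipschitzWith.of_le_add_mul _ fun x y => ?_
    change max 0 (min 1 (4 / ε * d x - 1)) ≤ max 0 (min 1 (4 / ε * d y - 1)) + 4 / ε * dist x y
    have h1 := mul_le_mul_of_nonneg_left (hd1 x y) hK
    have h2 : 0 ≤ 4 / ε * dist x y := by positivity
    rw [mul_add] at h1
    refine max_le (add_nonneg (le_max_left _ _) h2) ?_
    rcases le_total 1 (4 / ε * d y - 1) with h | h
    · rw [min_eq_left h]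
      have := le_max_right (0 : ℝ) 1
      have := min_le_left (1 : ℝ) (4 / ε * d x - 1)
      linarith
    · rw [min_eq_right h]
      have := le_max_right (0 : ℝ) (4 / ε * d y - 1)
      have := min_le_right (1 : ℝ) (4 / ε * d x - 1)
      linarith
  have f0 : ∀ x, d x ≤ ε / 4 → f x = 0 := fun x hx => by
    have : 4 / ε * d x ≤ 1 := by
      rw [div_mul_eq_mul_div, div_le_one hε]; linarith
    exact max_eq_left ((min_le_right _ _).trans (by linarith))
  have f1 : ∀ x, ε / 2 ≤ d x → f x = 1 := fun x hx => by
    have : 2 ≤ 4 / ε * d x := by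
      rw [div_mul_eq_mul_div, le_div_iff₀ hε]; linarith
    change max 0 (min 1 (4 / ε * d x - 1)) = 1
    rw [min_eq_left (by linarith)]
    norm_num
  have fabs : ∀ x, |f x| ≤ 1 := fun x => by
    rw [abs_of_nonneg (le_max_left _ _)]
    exact max_le zero_le_one (min_le_left _ _)
  -- The profile `f` is `0` where `d ≤ ε / 4` and `1` where `d ≥ ε / 2`. Averaging over radius `ε /
  -- 8` leaves it `0` where `d < ε / 8` and `1` where `d ≥ 3 ε / 4`.
  let b : ContDiffBump (0 : Plane) := ⟨ε / 16, ε / 8, by positivity, by linarith⟩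
  have hconst : ∀ x (a : ℝ), (∀ y, dist y x < ε / 8 → f y = a) → mollify b f x = a := by
    intro x a h
    have hx : f x = a := h x (by simpa using hε)
    rw [mollify_eq_convolution_left, b.normed_convolution_eq_right, hx]
    intro y hy
    rw [h y hy, hx]
  have hψ1 : ∀ x, 3 / 4 * ε ≤ d x → mollify b f x = 1 := fun x hx =>
    hconst x 1 fun y hy => f1 y (by have := hd1 x y; rw [dist_comm] at this; linarith)
  have hψ0 : ∀ x, d x < ε / 8 → mollify b f x = 0 := fun x hx =>
    hconst x 0 fun y hy => f0 y (by have := hd1 y x; linarith)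
  have hsupp : tsupport (mollify b f) ⊆ {x | ε / 8 ≤ d x} := by
    refine closure_minimal (fun x hx => ?_)
      (isClosed_le continuous_const (Metric.continuous_infDist_pt _))
    by_contra h
    exact hx (hψ0 x (not_le.1 h))
  have hsub : tsupport (mollify b f) ⊆ U := fun x hx => by
    by_contra h
    have h1 : d x = 0 := Metric.infDist_zero_of_mem h
    have h2 : ε / 8 ≤ d x := hsupp hx
    linarith
  refine ⟨mollify b f, ⟨contDiff_mollify b hlip.continuous.locallyIntegrable, ?_, hsub⟩,
    abs_mollify_le b (Eventually.of_forall fabs), fun i x => ?_, fun x hx => ?_⟩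
  · exact Metric.isCompact_of_isClosed_isBounded (isClosed_tsupport _) (hUb.subset hsub)
  · have h1 : ‖fderiv ℝ (mollify b f) x‖ ≤ 4 / ε :=
      norm_fderiv_le_of_lipschitz ℝ (LipschitzWith.mollify hlip b)
    have h2 := (fderiv ℝ (mollify b f) x).le_opNorm (e i)
    rw [show ‖e i‖ = 1 by simp [e], mul_one] at h2
    exact h2.trans h1
  · have hdx : ε ≤ d x := by
      refine (Metric.le_infDist hne).2 fun y hy => ?_
      by_contra! h
      exact hy (hx (by rwa [Metric.mem_ball, dist_comm]))
    refine ⟨hψ1 x (by linarith), fun i => ?_⟩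
    have : mollify b f =ᶠ[𝓝 x] fun _ => (1 : ℝ) := by
      filter_upwards [Metric.ball_mem_nhds x (show 0 < ε / 4 by positivity)] with y hy
      refine hψ1 y ?_
      have := hd1 x y
      rw [Metric.mem_ball, dist_comm] at hy
      linarith
    rw [pd, this.fderiv_eq]
    simp

end

/-! ### Rescaling, orthogonality relations and the energy inequality -/

section

variable {U L : Set Plane} {u φ N : Plane → ℝ} {g F D R H : Plane → Plane} {κ₁ κ₂ K ε ρ : ℝ}
  {A B : Plane → Matrix (Fin 2) (Fin 2) ℝ}

theorem ae_rescale {P : Plane → Prop} (h : ∀ᵐ y, P y) (hε : ε ≠ 0) :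
    ∀ᵐ x : Plane, P (ε⁻¹ • x) := by
  simpa using ae_comp_smul_add h (inv_ne_zero hε) 0

theorem IsElliptic.rescale (hA : IsElliptic κ₁ κ₂ A) (hε : ε ≠ 0) :
    IsElliptic κ₁ κ₂ (rescale ε A) where
  meas i j := (hA.meas i j).comp_quasiMeasurePreserving
    (Measure.quasiMeasurePreserving_smul volume (inv_ne_zero hε))
  symm := ae_rescale hA.symm hε
  bounds := ae_rescale hA.bounds hε

/-- The factor `ε` cancels the `ε⁻¹` of the chain rule: the function is of order `ε`, its gradient
of order one. -/
theorem HasWeakGrad.rescale (hg : HasWeakGrad Set.univ u g) (hε : ε ≠ 0) :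
    HasWeakGrad Set.univ (fun x => ε * rescale ε u x) (rescale ε g) := by
  have h := (hg.comp_smul_add (inv_ne_zero hε) 0).const_mul ε
  simpa [Homog.rescale, Function.comp_def, smul_smul, hε] using! h

theorem IsCorrector.integral_flux_rescale {l : Fin 2} (hN : IsCorrector A l N)
    (hA : IsElliptic κ₁ κ₂ A) (hκ₁ : 0 < κ₁) (hper : IsPeriodic A)
    (hg : HasWeakGrad Set.univ N g) (hε : ε ≠ 0) (hφ : IsTest U φ) :
    ∫ x in U, ∑ i, flux (Homog.rescale ε A x) (e l + Homog.rescale ε g x) i * pd i φ x = 0 := by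
  rw [setIntegral_eq_integral_of_forall_compl_eq_zero fun x hx =>
    Finset.sum_eq_zero fun i _ => by rw [(hφ.pd i).eq_zero hx, mul_zero]]
  exact integral_mul_pd_comp_smul (V := fun y => flux (A y) (e l + g y)) (inv_ne_zero hε)
    (fun φ hφ => hN.integral_flux_eq_zero hA hκ₁ hper hg hφ) (hφ.mono (Set.subset_univ U))

theorem MemLp.coord {μ : Measure Plane} {p : ℝ≥0∞} (hg : MemLp g p μ) (i : Fin 2) :
    MemLp (fun x => g x i) p μ :=
  (EuclideanSpace.proj (𝕜 := ℝ) i).comp_memLp' hg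

theorem integrable_sum_mul {μ : Measure Plane} (hH : MemLp H 2 μ) (hD : MemLp D 2 μ) :
    Integrable (fun x => ∑ i, H x i * D x i) μ :=
  integrable_finsetSum _ fun i _ => (MemLp.coord hH i).integrable_mul (MemLp.coord hD i)

theorem IsTest.memLp_pd [IsFiniteMeasure (volume.restrict U)] (hφ : IsTest U φ) (i : Fin 2) :
    MemLp (Homog.pd i φ) 2 (volume.restrict U) := by
  obtain ⟨C, hC⟩ := (hφ.pd i).compact.exists_bound_of_continuous (hφ.pd i).smooth.continuous
  exact MemLp.of_bound (hφ.pd i).smooth.continuous.aestronglyMeasurable C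
    (Eventually.of_forall hC)

/-- A divergence free `L²` field is orthogonal to limits of gradients of test functions. -/
theorem integral_mul_limit_eq_zero [IsFiniteMeasure (volume.restrict U)]
    (hH : MemLp H 2 (volume.restrict U)) (hD : MemLp D 2 (volume.restrict U))
    (h0 : ∀ φ, IsTest U φ → ∫ x in U, ∑ i, H x i * pd i φ x = 0) {φ : ℕ → Plane → ℝ}
    (hφ : ∀ n, IsTest U (φ n))
    (hlim : ∀ i : Fin 2, Tendsto (fun n => eLpNorm (fun x => D x i - pd i (φ n) x) 2
      (volume.restrict U)) atTop (𝓝 0)) :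
    ∫ x in U, ∑ i, H x i * D x i = 0 := by
  have hi : ∀ i n, Integrable (fun x => H x i * pd i (φ n) x) (volume.restrict U) := fun i n =>
    (MemLp.coord hH i).integrable_mul ((hφ n).memLp_pd i)
  have hiD : ∀ i, Integrable (fun x => H x i * D x i) (volume.restrict U) := fun i =>
    (MemLp.coord hH i).integrable_mul (MemLp.coord hD i)
  have key : ∀ i, Tendsto (fun n => ∫ x in U, H x i * pd i (φ n) x) atTop
      (𝓝 (∫ x in U, H x i * D x i)) := by
    intro i
    refine tendsto_integral_of_L1' _ (hiD i).1 (Eventually.of_forall (hi i)) ?_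
    -- Hölder's inequality turns `L²` convergence of the gradients into `L¹` convergence of the
    -- products.
    have hb : ∀ n, eLpNorm ((fun x => H x i * pd i (φ n) x) - fun x => H x i * D x i) 1
        (volume.restrict U) ≤ eLpNorm (fun x => H x i) 2 (volume.restrict U) *
          eLpNorm (fun x => D x i - pd i (φ n) x) 2 (volume.restrict U) := by
      intro n
      have h1 := eLpNorm_smul_le_mul_eLpNorm (p := 2) (q := 2) (r := 1)
        ((MemLp.coord hD i).1.sub ((hφ n).memLp_pd i).1) (MemLp.coord hH i).1
      refine le_trans (le_of_eq ?_) h1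
      rw [← eLpNorm_neg]
      congr 1
      ext x
      simp only [Pi.neg_apply, Pi.sub_apply, Pi.smul_apply', smul_eq_mul]
      ring
    refine tendsto_of_tendsto_of_tendsto_of_le_of_le tendsto_const_nhds ?_ (fun _ => zero_le) hb
    have := ENNReal.Tendsto.const_mul (a := eLpNorm (fun x => H x i) 2 (volume.restrict U))
      (hlim i) (Or.inr (MemLp.coord hH i).2.ne)
    simpa using this
  have hsum := tendsto_finsetSum Finset.univ fun i _ => key i
  rw [← integral_finsetSum _ fun i _ => hiD i] at hsum
  refine tendsto_nhds_unique hsum ?_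
  have : ∀ n, ∑ i, ∫ x in U, H x i * pd i (φ n) x = 0 := fun n => by
    rw [← integral_finsetSum _ fun i _ => hi i n]
    exact h0 _ (hφ n)
  simp only [this]
  exact tendsto_const_nhds

theorem abs_sum_mul_le (ξ η : Plane) : |∑ i, ξ i * η i| ≤ ‖ξ‖ * ‖η‖ := by
  have := abs_real_inner_le_norm η ξ
  rw [PiLp.inner_apply] at this
  rw [mul_comm]
  simpa using this

/-- If `∫ B F · F = - ∫ B F · R`, where `R` is bounded by `ρ` on `L` and vanishes outside `L`,
then the square of the `L²` norm of `F` is controlled by `ρ² |L|`. -/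
theorem energy_bound [IsFiniteMeasure (volume.restrict U)] (hκ₁ : 0 < κ₁)
    (hBm : ∀ i j, AEMeasurable (fun y => B y i j) volume) (hBK : ∀ᵐ x, ∀ i j, |B x i j| ≤ K)
    (hBc : ∀ᵐ x, ∀ ξ : Plane, κ₁ * ‖ξ‖ ^ 2 ≤ form (B x) ξ ξ) (hL : MeasurableSet L) (hLU : L ⊆ U)
    (hF : MemLp F 2 (volume.restrict U)) (hR : ∀ᵐ x ∂volume.restrict U, ‖R x‖ ≤ L.indicator (fun _ => ρ) x)
    (heq : ∫ x in U, ∑ i, flux (B x) (F x) i * F x i =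
      - ∫ x in U, ∑ i, flux (B x) (F x) i * R x i) :
    ∫ x in U, ‖F x‖ ^ 2 ≤ 4 * K ^ 2 / κ₁ ^ 2 * (ρ ^ 2 * volume.real L) := by
  have hH : MemLp (fun x => flux (B x) (F x)) 2 (volume.restrict U) :=
    memLp_flux (fun i j => (hBm i j).restrict) (ae_restrict_of_ae hBK) hF
  have hF2 : Integrable (fun x => ‖F x‖ ^ 2) (volume.restrict U) := hF.integrable_norm_pow (by simp)
  have hL2 : Integrable (L.indicator fun _ => ρ ^ 2) (volume.restrict U) :=
    (integrable_const (ρ ^ 2)).indicator hL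
  have h1 : κ₁ * ∫ x in U, ‖F x‖ ^ 2 ≤ ∫ x in U, ∑ i, flux (B x) (F x) i * F x i := by
    rw [← integral_const_mul]
    refine integral_mono_ae (hF2.const_mul κ₁) (integrable_sum_mul hH hF) (ae_restrict_of_ae ?_)
    filter_upwards [hBc] with x hx
    have := hx (F x)
    rwa [form_eq_flux] at this
  have h2 : - ∫ x in U, ∑ i, flux (B x) (F x) i * R x i ≤
      ∫ x in U, (κ₁ / 2 * ‖F x‖ ^ 2 + 2 * K ^ 2 / κ₁ * L.indicator (fun _ => ρ ^ 2) x) := by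
    refine (neg_le_abs _).trans ?_
    rw [← Real.norm_eq_abs]
    refine norm_integral_le_of_norm_le ((hF2.const_mul _).add (hL2.const_mul _)) ?_
    filter_upwards [hR, ae_restrict_of_ae hBK] with x hx hK
    rw [Real.norm_eq_abs]
    have hK0 : 0 ≤ K := (abs_nonneg _).trans (hK 0 0)
    have a1 := (abs_sum_mul_le (flux (B x) (F x)) (R x)).trans
      (mul_le_mul_of_nonneg_right (norm_flux_le hK (F x)) (norm_nonneg (R x)))
    have a2 : ‖R x‖ ^ 2 ≤ L.indicator (fun _ => ρ ^ 2) x := by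
      by_cases hxL : x ∈ L
      · rw [Set.indicator_of_mem hxL] at hx ⊢
        exact pow_le_pow_left₀ (norm_nonneg _) hx 2
      · rw [Set.indicator_of_notMem hxL] at hx ⊢
        rw [le_antisymm hx (norm_nonneg _)]; simp
    -- Young's inequality, weighted so that half of the coercivity term `κ₁ ‖F‖²` survives
    -- absorption.
    have a3 : 2 * K * ‖F x‖ * ‖R x‖ ≤ κ₁ / 2 * ‖F x‖ ^ 2 + 2 * K ^ 2 / κ₁ * ‖R x‖ ^ 2 := by
      have : κ₁ / 2 * ‖F x‖ ^ 2 + 2 * K ^ 2 / κ₁ * ‖R x‖ ^ 2 - 2 * K * ‖F x‖ * ‖R x‖ =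
          (κ₁ * ‖F x‖ - 2 * K * ‖R x‖) ^ 2 / (2 * κ₁) := by
        field_simp; ring
      have h' : 0 ≤ (κ₁ * ‖F x‖ - 2 * K * ‖R x‖) ^ 2 / (2 * κ₁) := by positivity
      linarith
    have a4 : 2 * K ^ 2 / κ₁ * ‖R x‖ ^ 2 ≤ 2 * K ^ 2 / κ₁ * L.indicator (fun _ => ρ ^ 2) x :=
      mul_le_mul_of_nonneg_left a2 (by positivity)
    linarith
  rw [integral_add (hF2.const_mul _) (hL2.const_mul _), integral_const_mul, integral_const_mul,
    integral_indicator hL, Measure.restrict_restrict_of_subset hLU, setIntegral_const,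
    smul_eq_mul] at h2
  rw [heq] at h1
  have h3 := h1.trans h2
  have h4 : κ₁ / 2 * ∫ x in U, ‖F x‖ ^ 2 ≤ 2 * K ^ 2 / κ₁ * (volume.real L * ρ ^ 2) := by linarith
  have h5 : ∫ x in U, ‖F x‖ ^ 2 ≤ 2 / κ₁ * (2 * K ^ 2 / κ₁ * (volume.real L * ρ ^ 2)) := by
    have := mul_le_mul_of_nonneg_left h4 (show 0 ≤ 2 / κ₁ by positivity)
    rwa [← mul_assoc, show 2 / κ₁ * (κ₁ / 2) = 1 by field_simp, one_mul] at this
  refine h5.trans (le_of_eq ?_)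
  field_simp; ring

theorem eLpNorm_two_eq {μ : Measure Plane} (hF : MemLp F 2 μ) :
    eLpNorm F 2 μ = ENNReal.ofReal (Real.sqrt (∫ x, ‖F x‖ ^ 2 ∂μ)) := by
  rw [hF.eLpNorm_eq_integral_rpow_norm (by simp) (by simp), Real.sqrt_eq_rpow]
  simp

end

/-! ### The estimate for the corrected error -/

theorem norm_le_of_abs_coord_le {ξ : Plane} {K : ℝ} (h : ∀ i, |ξ i| ≤ K) : ‖ξ‖ ≤ 2 * K := by
  have hK : 0 ≤ K := (abs_nonneg _).trans (h 0)
  refine le_of_sq_le_sq ?_ (by positivity)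
  rw [EuclideanSpace.real_norm_sq_eq, Fin.sum_univ_two]
  have h0 := sq_le_sq' (abs_le.1 (h 0)).1 (abs_le.1 (h 0)).2
  have h1 := sq_le_sq' (abs_le.1 (h 1)).1 (abs_le.1 (h 1)).2
  nlinarith

/-- The classical gradient. -/
def gradVec (ψ : Plane → ℝ) (x : Plane) : Plane := WithLp.toLp 2 fun i => pd i ψ x

theorem IsTest.continuous_gradVec {U : Set Plane} {ψ : Plane → ℝ} (hψ : IsTest U ψ) :
    Continuous (gradVec ψ) :=
  (PiLp.continuous_toLp 2 _).comp (continuous_pi fun i => (hψ.pd i).smooth.continuous)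

/-- The energy estimate for the gradient of `wε - w₀ - p_l v_l`, where the functions
`p_l v_l` correct the affine function `w₀` with gradient `p` to a solution in the plane. -/
theorem corrected_energy_bound {U : Set Plane} {B : Plane → Matrix (Fin 2) (Fin 2) ℝ}
    {κ₁ κ₂ M r ε : ℝ} {c : Plane} (hκ₁ : 0 < κ₁) (hUo : IsOpen U) (hU : Convex ℝ U)
    (hUb : Bornology.IsBounded U) (hr : Metric.ball c r ⊆ U) (hε : 0 < ε) (hεr : ε ≤ r)
    (hB : IsElliptic κ₁ κ₂ B) {v : Fin 2 → Plane → ℝ} {γ : Fin 2 → Plane → Plane}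
    (hv : ∀ l, HasWeakGrad Set.univ (v l) (γ l)) (hvM : ∀ l, ∀ᵐ x, |v l x| ≤ ε * M)
    (hγM : ∀ l, ∀ᵐ x, ∀ i, |γ l x i| ≤ M)
    (hγ : ∀ l φ, IsTest U φ → ∫ x in U, ∑ i, flux (B x) (e l + γ l x) i * pd i φ x = 0)
    {gw D : Plane → Plane} {p : Plane} (hD : MemLp D 2 (volume.restrict U))
    (hgwD : gw =ᵐ[volume.restrict U] fun x => D x + p)
    (hgw : ∀ φ, IsTest U φ → ∫ x in U, ∑ i, flux (B x) (gw x) i * pd i φ x = 0)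
    {φ : ℕ → Plane → ℝ} (hφ : ∀ n, IsTest U (φ n))
    (hlim : ∀ i : Fin 2, Tendsto (fun n => eLpNorm (fun x => D x i - pd i (φ n) x) 2
      (volume.restrict U)) atTop (𝓝 0)) :
    MemLp (fun x => D x - (p 0 • γ 0 x + p 1 • γ 1 x)) 2 (volume.restrict U) ∧
      ∫ x in U, ‖D x - (p 0 • γ 0 x + p 1 • γ 1 x)‖ ^ 2 ≤
        (96 * κ₂ * M / κ₁) ^ 2 * (ε / r) * (‖p‖ ^ 2 * volume.real U) := by
  have hfin : volume U < ⊤ := hUb.measure_lt_top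
  have : IsFiniteMeasure (volume.restrict U) := ⟨by simpa using hfin⟩
  have hBK := hB.abs_entry_le hκ₁
  have hM : 0 ≤ M := by
    obtain ⟨x, hx⟩ := (hγM 0).exists
    exact (abs_nonneg _).trans (hx 0)
  have hγL : ∀ l, MemLp (γ l) 2 (volume.restrict U) := fun l => by
    refine MemLp.of_bound
      (locallyIntegrableOn_univ.1 (hv l).locInt_grad).aestronglyMeasurable.restrict (2 * M) ?_
    exact ae_restrict_of_ae ((hγM l).mono fun x hx => norm_le_of_abs_coord_le hx)
  set F : Plane → Plane := fun x => D x - (p 0 • γ 0 x + p 1 • γ 1 x) with hFdef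
  have hF : MemLp F 2 (volume.restrict U) :=
    hD.sub (((hγL 0).const_smul (p 0)).add ((hγL 1).const_smul (p 1)))
  refine ⟨hF, ?_⟩
  have hflux : ∀ {ξ : Plane → Plane}, MemLp ξ 2 (volume.restrict U) →
      MemLp (fun x => flux (B x) (ξ x)) 2 (volume.restrict U) := fun hξ =>
    memLp_flux (fun i j => (hB.meas i j).restrict) (ae_restrict_of_ae hBK) hξ
  have hp : p = p 0 • e 0 + p 1 • e 1 := by
    ext i; fin_cases i <;> simp [e]
  -- Since `p = p_l e_l`, one has `F = gw - p_l (e_l + γ_l)`, a combination of fields whose fluxes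
  -- are divergence free.
  have hH0 : ∀ φ, IsTest U φ → ∫ x in U, ∑ i, flux (B x) (F x) i * pd i φ x = 0 := by
    intro φ hφ
    have hWint : ∀ {ξ : Plane → Plane}, MemLp ξ 2 (volume.restrict U) →
        Integrable (fun x => ∑ i, flux (B x) (ξ x) i * pd i φ x) (volume.restrict U) := fun hξ =>
      integrable_finsetSum _ fun i _ =>
        (MemLp.coord (hflux hξ) i).integrable_mul (hφ.memLp_pd i)
    have hgwL : MemLp gw 2 (volume.restrict U) :=
      (memLp_congr_ae hgwD).2 (hD.add (memLp_const p))
    have hi1 := hWint hgwL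
    have hi2 : ∀ l, Integrable (fun x => p l * ∑ i, flux (B x) (e l + γ l x) i * pd i φ x)
        (volume.restrict U) := fun l => (hWint ((memLp_const (e l)).add (hγL l))).const_mul (p l)
    have heq : ∫ x in U, ∑ i, flux (B x) (F x) i * pd i φ x =
        ∫ x in U, (∑ i, flux (B x) (gw x) i * pd i φ x -
          (p 0 * ∑ i, flux (B x) (e 0 + γ 0 x) i * pd i φ x +
            p 1 * ∑ i, flux (B x) (e 1 + γ 1 x) i * pd i φ x)) := by
      refine integral_congr_ae ?_
      filter_upwards [hgwD] with x hx
      have : F x = gw x - (p 0 • (e 0 + γ 0 x) + p 1 • (e 1 + γ 1 x)) := by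
        rw [hx, hFdef]
        nth_rewrite 3 [hp]
        module
      rw [this]
      simp only [flux_sub, flux_add, flux_smul, PiLp.sub_apply, PiLp.add_apply, PiLp.smul_apply,
        smul_eq_mul, Fin.sum_univ_two]
      ring
    rw [heq, integral_sub hi1 ((hi2 0).fun_add (hi2 1)), integral_add (hi2 0) (hi2 1),
      integral_const_mul, integral_const_mul, hgw φ hφ, hγ 0 φ hφ, hγ 1 φ hφ]
    simp
  obtain ⟨ψ, hψ, hψ1, hψd, hψb⟩ := exists_cutoff hUb hε
  obtain ⟨L, hLm, hLU, hLvol, hLb⟩ := exists_layer hUo hU hUb hr hε hεr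
  have hH := hflux hF
  have hS0 : ∀ l, ∫ x in U, ∑ i, flux (B x) (F x) i * (ψ x * γ l x i + v l x * pd i ψ x) = 0 := by
    intro l
    -- One constant must bound both the function and its gradient; its size does not enter the
    -- conclusion.
    refine integral_mul_grad_mul_eq_zero (K := max M (ε * M)) (hH.integrable (by norm_num)) hH0 hψ
      (hv l) ?_ ?_
    · exact (hvM l).mono fun x hx => hx.trans (le_max_right _ _)
    · exact (hγM l).mono fun x hx i => (hx i).trans (le_max_left _ _)
  set S : Fin 2 → Plane → Plane := fun l x => ψ x • γ l x + v l x • gradVec ψ x with hS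
  have hSi : ∀ l x i, S l x i = ψ x * γ l x i + v l x * pd i ψ x := fun l x i => by
    simp [hS, gradVec]
  have hvdψ : ∀ l, ∀ᵐ x, ∀ i, |v l x * pd i ψ x| ≤ 4 * M := fun l => by
    filter_upwards [hvM l] with x hx i
    rw [abs_mul]
    calc |v l x| * |pd i ψ x| ≤ (ε * M) * (4 / ε) :=
          mul_le_mul hx (hψd i x) (abs_nonneg _) (by positivity)
      _ = 4 * M := by field_simp
  have hSL : ∀ l, MemLp (S l) 2 (volume.restrict U) := fun l => by
    refine MemLp.of_bound (AEStronglyMeasurable.add ?_ ?_) (2 * (5 * M)) (ae_restrict_of_ae ?_)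
    · exact hψ.smooth.continuous.aestronglyMeasurable.smul (hγL l).1
    · exact (locallyIntegrableOn_univ.1 (hv l).locInt).aestronglyMeasurable.restrict.smul
        hψ.continuous_gradVec.aestronglyMeasurable
    · filter_upwards [hγM l, hvdψ l] with x h1 h2
      refine norm_le_of_abs_coord_le fun i => ?_
      rw [hSi]
      have h3 : |ψ x * γ l x i| ≤ M := by
        rw [abs_mul]
        calc |ψ x| * |γ l x i| ≤ 1 * M := mul_le_mul (hψ1 x) (h1 i) (abs_nonneg _) zero_le_one
          _ = M := one_mul M
      exact (abs_add_le _ _).trans (by linarith [h2 i])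
  -- This is `p_l (γ_l - S_l)`, the gradient of `p_l (1 - ψ) v_l`.
  set R : Plane → Plane := fun x => D x - F x - (p 0 • S 0 x + p 1 • S 1 x) with hRdef
  have hRi : ∀ x i, R x i = p 0 * ((1 - ψ x) * γ 0 x i - v 0 x * pd i ψ x) +
      p 1 * ((1 - ψ x) * γ 1 x i - v 1 x * pd i ψ x) := fun x i => by
    simp only [hRdef, hFdef, PiLp.sub_apply, PiLp.add_apply, PiLp.smul_apply, smul_eq_mul, hSi]
    ring
  have hRb : ∀ᵐ x ∂volume.restrict U, ‖R x‖ ≤ L.indicator (fun _ => 24 * M * ‖p‖) x := by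
    filter_upwards [ae_restrict_of_ae (ae_all_iff.2 hγM), ae_restrict_of_ae (ae_all_iff.2 hvdψ),
      ae_restrict_mem hUo.measurableSet] with x h1 h2 hxU
    by_cases hxL : x ∈ L
    · rw [Set.indicator_of_mem hxL, show 24 * M * ‖p‖ = 2 * (12 * M * ‖p‖) by ring]
      refine norm_le_of_abs_coord_le fun i => ?_
      -- The bound `6 M` is `2 M` from `(1 - ψ) γ_l` plus `4 M` from `v_l ∇ψ`. Summing over `l`
      -- gives `12 M ‖p‖` per coordinate, and passing to the norm doubles it.
      have hl : ∀ l, |p l * ((1 - ψ x) * γ l x i - v l x * pd i ψ x)| ≤ ‖p‖ * (6 * M) := by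
        intro l
        rw [abs_mul]
        refine mul_le_mul (PiLp.norm_apply_le p l) ?_ (abs_nonneg _) (norm_nonneg _)
        refine (abs_sub _ _).trans ?_
        have h3 : |1 - ψ x| ≤ 2 := (abs_sub _ _).trans (by rw [abs_one]; linarith [hψ1 x])
        have h4 : |(1 - ψ x) * γ l x i| ≤ 2 * M := by
          rw [abs_mul]
          exact mul_le_mul h3 (h1 l i) (abs_nonneg _) zero_le_two
        linarith [h2 l i]
      rw [hRi]
      exact (abs_add_le _ _).trans (by linarith [hl 0, hl 1])
    · obtain ⟨h3, h4⟩ := hψb x (hLb x hxU hxL)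
      have : R x = 0 := by
        ext i
        rw [hRi, h3, h4 i]
        simp
      simp [this, hxL]
  have hDz := integral_mul_limit_eq_zero hH hD hH0 hφ hlim
  -- The flux of `F` is orthogonal to `D` and to each `S_l`, hence to `F + R = D - p_l S_l`.
  have henergy : ∫ x in U, ∑ i, flux (B x) (F x) i * F x i =
      - ∫ x in U, ∑ i, flux (B x) (F x) i * R x i := by
    have hpt : ∀ x, ∑ i, flux (B x) (F x) i * R x i =
        ∑ i, flux (B x) (F x) i * D x i - ∑ i, flux (B x) (F x) i * F x i -
          (p 0 * ∑ i, flux (B x) (F x) i * S 0 x i + p 1 * ∑ i, flux (B x) (F x) i * S 1 x i) := by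
      intro x
      simp only [hRdef, PiLp.sub_apply, PiLp.add_apply, PiLp.smul_apply, smul_eq_mul,
        Fin.sum_univ_two]
      ring
    have hSz : ∀ l, ∫ x in U, ∑ i, flux (B x) (F x) i * S l x i = 0 := fun l => by
      simpa only [hSi] using hS0 l
    simp only [hpt]
    have j1 := integrable_sum_mul hH hD
    have j2 := integrable_sum_mul hH hF
    have j12 : Integrable (fun x => ∑ i, flux (B x) (F x) i * D x i -
        ∑ i, flux (B x) (F x) i * F x i) (volume.restrict U) := j1.sub j2
    have j3 := fun l => (integrable_sum_mul hH (hSL l)).const_mul (p l)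
    rw [integral_sub j12 ((j3 0).fun_add (j3 1)), integral_sub j1 j2,
      integral_add (j3 0) (j3 1), integral_const_mul, integral_const_mul, hSz, hSz, hDz]
    ring
  have hmain := energy_bound hκ₁ hB.meas hBK (hB.bounds.mono fun x h ξ => (h ξ).1) hLm hLU hF hRb
    henergy
  have hr0 : 0 < r := hε.trans_le hεr
  have hvol : volume.real L ≤ 2 * (ε / r) * volume.real U := by
    have := ENNReal.toReal_mono (ENNReal.mul_ne_top ENNReal.ofReal_ne_top hfin.ne) hLvol
    rwa [ENNReal.toReal_mul, ENNReal.toReal_ofReal (by positivity)] at this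
  calc ∫ x in U, ‖F x‖ ^ 2
      ≤ 4 * κ₂ ^ 2 / κ₁ ^ 2 * ((24 * M * ‖p‖) ^ 2 * volume.real L) := hmain
    _ ≤ 4 * κ₂ ^ 2 / κ₁ ^ 2 * ((24 * M * ‖p‖) ^ 2 * (2 * (ε / r) * volume.real U)) := by
        gcongr
    _ = 1 / 2 * ((96 * κ₂ * M / κ₁) ^ 2 * (ε / r) * (‖p‖ ^ 2 * volume.real U)) := by
        field_simp; ring
    _ ≤ (96 * κ₂ * M / κ₁) ^ 2 * (ε / r) * (‖p‖ ^ 2 * volume.real U) := by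
        have : 0 ≤ (96 * κ₂ * M / κ₁) ^ 2 * (ε / r) * (‖p‖ ^ 2 * volume.real U) := by positivity
        linarith

/-- The seminorm is an infimum, so a lower bound needs uniqueness of the weak gradient, whereas an
upper bound needs only one gradient. -/
theorem le_h1Seminorm_affine {U : Set Plane} (hU : IsOpen U) (w : Plane →ᵃ[ℝ] ℝ) :
    eLpNorm (fun _ => affineGrad w) 2 (volume.restrict U) ≤ h1Seminorm U w :=
  le_iInf₂ fun _ hg =>
    (eLpNorm_congr_ae ((hasWeakGrad_affine w).ae_eq hU hg)).le

end Homog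

end

/-! ### The main theorem -/

theorem mainTheorem4 (κ₁ κ₂ M : ℝ) (hκ₁ : 0 < κ₁) :
    ∃ C : ℝ, 0 < C ∧
      ∀ (A : Homog.Plane → Matrix (Fin 2) (Fin 2) ℝ) (N : Fin 2 → Homog.Plane → ℝ),
        Homog.IsPeriodic A → Homog.IsElliptic κ₁ κ₂ A →
        (∀ l, Homog.IsCorrector A l (N l)) →
        (∀ l, Homog.MemW1Per ⊤ (N l)) →
        (⨆ l, Homog.w1InfNorm Homog.cell (N l)) ≤ ENNReal.ofReal M →
        ∀ (T : Affine.Triangle ℝ Homog.Plane) (ε : ℝ), 0 < ε → ε ≤ T.inradius →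
        ∀ (w₀ : Homog.Plane →ᵃ[ℝ] ℝ) (wε : Homog.Plane → ℝ),
          Homog.IsDirichletSolution (Homog.rescale ε A) (Homog.openTriangle T) w₀ wε →
          Homog.h1Seminorm (Homog.openTriangle T)
              (fun x => wε x - Homog.firstOrder ε N w₀ x) ≤
            ENNReal.ofReal (C * Real.sqrt (ε / T.inradius)) *
              Homog.h1Seminorm (Homog.openTriangle T) w₀ := by
  set C₀ : ℝ := 96 * κ₂ * max M 0 / κ₁ with hC₀
  -- The sign of `κ₂` is not known at this point, and `C₀` may vanish; this choice is positive in
  -- every case.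
  refine ⟨|C₀| + 1, by positivity, ?_⟩
  intro A N hper hA hN hW hM T ε hε hεr w₀ wε hsol
  set U := Homog.openTriangle T with hUdef
  have hUo : IsOpen U := isOpen_interior
  have hUb := Homog.isBounded_openTriangle T
  have hr0 : 0 < T.inradius := hε.trans_le hεr
  have : IsFiniteMeasure (volume.restrict U) := ⟨by simpa using hUb.measure_lt_top⟩
  choose g hg using fun l => (hW l).2.2
  have hb := fun l => Homog.ae_bound_of_w1InfNorm_le (hW l).1 (hg l).1 ((le_iSup _ l).trans hM)
  obtain ⟨-, ⟨gw, hgw, hgw0⟩, -, D, hD, hDL, φ, hφ, -, hlim⟩ := hsol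
  set p := Homog.affineGrad w₀ with hp
  have hv := fun l => (hg l).1.rescale hε.ne'
  -- The gradient of `wε` is recovered from that of `wε - w₀`; by uniqueness it agrees with the `gw`
  -- of the equation.
  have hwD : Homog.HasWeakGrad U wε (fun x => D x + p) := by
    simpa using hD.add (Homog.hasWeakGrad_affine w₀)
  obtain ⟨hF, hbound⟩ := Homog.corrected_energy_bound hκ₁ hUo (Homog.convex_openTriangle T) hUb
    (Homog.ball_subset_openTriangle T) hε hεr (hA.rescale hε.ne') (M := max M 0) hv
    (fun l => (Homog.ae_rescale (hb l).1 hε.ne').mono fun x hx => by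
      rw [abs_mul, abs_of_pos hε]
      exact mul_le_mul_of_nonneg_left hx hε.le)
    (fun l => Homog.ae_rescale (hb l).2 hε.ne')
    (fun l φ hφ => (hN l).integral_flux_rescale hA hκ₁ hper (hg l).1 hε.ne' hφ)
    hDL (hgw.ae_eq hUo hwD)
    (fun φ hφ => by simpa only [Homog.form_eq_flux] using hgw0 φ hφ) hφ hlim
  have hgrad : Homog.HasWeakGrad U (fun x => wε x - Homog.firstOrder ε N w₀ x)
      (fun x => D x - (p 0 • Homog.rescale ε (g 0) x + p 1 • Homog.rescale ε (g 1) x)) := by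
    have h := hD.sub (((hv 0).restrict.const_mul (p 0)).add ((hv 1).restrict.const_mul (p 1)))
    convert h using 2 with x
    simp only [Homog.firstOrder, Fin.sum_univ_two, Homog.pd_affine, ← hp]
    ring
  -- One explicit weak gradient bounds the infimum. Its finite `L²` norm also shows that the error
  -- has a gradient in `L²`.
  refine (iInf₂_le _ hgrad).trans ?_
  refine le_trans ?_ (mul_le_mul_right (Homog.le_h1Seminorm_affine hUo w₀) _)
  rw [Homog.eLpNorm_two_eq hF, Homog.eLpNorm_two_eq (memLp_const _), ← hp,
    ← ENNReal.ofReal_mul (by positivity)]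
  refine ENNReal.ofReal_le_ofReal ?_
  rw [integral_const, smul_eq_mul, measureReal_restrict_apply_univ]
  calc _ ≤ Real.sqrt (C₀ ^ 2 * (ε / T.inradius) * (‖p‖ ^ 2 * volume.real U)) :=
        Real.sqrt_le_sqrt hbound
    _ = |C₀| * Real.sqrt (ε / T.inradius) * Real.sqrt (volume.real U * ‖p‖ ^ 2) := by
        rw [Real.sqrt_mul (by positivity), Real.sqrt_mul (sq_nonneg _), Real.sqrt_sq_eq_abs,
          mul_comm (‖p‖ ^ 2)]
    _ ≤ _ := by
        gcongr
        linarith
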